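/- **Setting.** Let $\Phi\in\mathbb C^2\otimes\mathbb C^2$ be a fixed unit vector, let $U$ be distributed according to the Haar probability measure on the unitary group $\mathsf U(\mathbb C^2\otimes\mathbb C^2)$, and let $\rho=\operatorname{Tr}_2\big(U|\Phi\rangle\langle\Phi|U^\dagger\big)$ be the reduced state on $\mathbb C^2$ (partial trace over the second factor) of the Haar-random pure state $U|\Phi\rangle$. Let $\boldsymbol\sigma=(\sigma_1,\sigma_2,\sigma_3)$ be the Pauli matrices and let $A=a_0\mathbb 1+\boldsymbol a\cdot\boldsymbol\sigma$, $B=b_0\mathbb 1+\boldsymbol b\cdot\boldsymbol\sigma$, $C=c_0\mathbb 1+\boldsymbol c\cdot\boldsymbol\sigma$ with $(a_0,\boldsymbol a),(b_0,\boldsymbol b),(c_0,\boldsymbol c)\in\mathbb R^4$ be three qubit observables. Write $\langle A\rangle=\operatorname{Tr}(A\rho)$, and let $T$ be the $3\times3$ Gram matrix of $\boldsymbol a,\boldsymbol b,\boldsymbol c$, i.e. the matrix of their pairwise inner products. **(i)** One has $\operatorname{rank}T=3$ if and only if $\boldsymbol a,\boldsymbol b,\boldsymbol c$ are linearly independent.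 In this case the law of $(\langle A\rangle,\langle B\rangle,\langle C\rangle)$ has, with respect to Lebesgue measure on $\mathbb R^3$, the density $$f_{\langle A\rangle,\langle B\rangle,\langle C\rangle}(r,s,t)=\frac{3\,(1+\operatorname{sign}(1-\omega(r,s,t)))}{8\pi\sqrt{\det T}}=\begin{cases}\dfrac{3}{4\pi\sqrt{\det T}},&\omega(r,s,t)<1,\\[2mm] \dfrac{3}{8\pi\sqrt{\det T}},&\omega(r,s,t)=1,\\[2mm] 0,&\omega(r,s,t)>1,\end{cases}$$ where $\omega(r,s,t)=\sqrt{(r-a_0,s-b_0,t-c_0)\,T^{-1}(r-a_0,s-b_0,t-c_0)^{\mathsf T}}$. **(ii)** Suppose $\operatorname{rank}T=2$. Then, after relabelling the three observables, $\boldsymbol a,\boldsymbol b$ are linearly independent and $\boldsymbol c=\kappa_1\boldsymbol a+\kappa_2\boldsymbol b$ for some $\kappa_1,\kappa_2\in\mathbb R$; and for every such labelling and all such $\kappa_1,\kappa_2$, $$f_{\langle A\rangle,\langle B\rangle,\langle C\rangle}(r,s,t)=\delta\big((t-c_0)-\kappa_1(r-a_0)-\kappa_2(s-b_0)\big)\,f_{\langle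 A\rangle,\langle B\rangle}(r,s),$$ that is, the law of $(\langle A\rangle,\langle B\rangle,\langle C\rangle)$ is the image of the measure $f_{\langle A\rangle,\langle B\rangle}(r,s)\,dr\,ds$ under $(r,s)\mapsto(r,s,c_0+\kappa_1(r-a_0)+\kappa_2(s-b_0))$. Here $f_{\langle A\rangle,\langle B\rangle}$ is the density of the law of $(\langle A\rangle,\langle B\rangle)$ and is given by $$f_{\langle A\rangle,\langle B\rangle}(r,s)=\frac{3}{2\pi\sqrt{\det T'}}\sqrt{1-\omega'(r,s)^2}\;H(1-\omega'(r,s)),\qquad \omega'(r,s)=\sqrt{(r-a_0,s-b_0)\,T'^{-1}(r-a_0,s-b_0)^{\mathsf T}},$$ where $T'$ is the $2\times2$ Gram matrix of $\boldsymbol a,\boldsymbol b$ and $H$ is the Heaviside function ($H(x)=1$ for $x\ge0$ and $H(x)=0$ for $x<0$). **(iii)** Suppose $\operatorname{rank}T=1$. Then, after relabelling the three observables, $\boldsymbol b=\kappa_1\boldsymbol a$ and $\boldsymbol c=\kappa_2\boldsymbol a$ for some $\kappa_1,\kappa_2\in\mathbb R$; and for every such labelling and all such $\kappa_1,\kappa_2$,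 $$f_{\langle A\rangle,\langle B\rangle,\langle C\rangle}(r,s,t)=\delta\big((s-b_0)-\kappa_1(r-a_0)\big)\,\delta\big((t-c_0)-\kappa_2(r-a_0)\big)\,f_{\langle A\rangle}(r),$$ that is, the law of $(\langle A\rangle,\langle B\rangle,\langle C\rangle)$ is the image of the measure $f_{\langle A\rangle}(r)\,dr$ under $r\mapsto(r,\,b_0+\kappa_1(r-a_0),\,c_0+\kappa_2(r-a_0))$. Here $f_{\langle A\rangle}$ is the density of the law of $\langle A\rangle$ and is given, with $\lambda_1=a_0-|\boldsymbol a|$ and $\lambda_2=a_0+|\boldsymbol a|$ the eigenvalues of $A$, by $$f_{\langle A\rangle}(r)=\frac{3!}{(\lambda_2-\lambda_1)^3}(r-\lambda_1)(\lambda_2-r)\big(H(r-\lambda_1)-H(r-\lambda_2)\big).$$ -/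

import Mathlib

open MeasureTheory Matrix

noncomputable section

/-! ### The unitary group of `ℂ² ⊗ ℂ²` and its normalized Haar measure -/

/-- Index set of the product basis of `ℂ² ⊗ ℂ²`. -/
abbrev TwoQubitIndex : Type := Fin 2 × Fin 2

/-- The full unitary group `U(ℂ² ⊗ ℂ²)`, as unitary matrices in the product basis, with the
topology induced from matrices. -/
abbrev TwoQubitUnitary : Type := Matrix.unitaryGroup TwoQubitIndex ℂ

instance twoQubitUnitary_compactSpace : CompactSpace TwoQubitUnitary := by
  refine isCompact_iff_compactSpace.mp ?_
  have hK : IsCompact (Set.univ.pi fun _ : TwoQubitIndex =>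
      Set.univ.pi fun _ : TwoQubitIndex => Metric.closedBall (0 : ℂ) 1) :=
    isCompact_univ_pi fun _ => isCompact_univ_pi fun _ => isCompact_closedBall 0 1
  refine IsCompact.of_isClosed_subset hK
    (isClosed_unitary (R := Matrix TwoQubitIndex TwoQubitIndex ℂ)) ?_
  intro U hU i _ j _
  simpa using entry_norm_bound_of_unitary hU i j

/-- The unitary group carries its Borel σ-algebra. -/
instance twoQubitUnitary_measurableSpace : MeasurableSpace TwoQubitUnitary :=
  borel TwoQubitUnitary

instance twoQubitUnitary_borelSpace : BorelSpace TwoQubitUnitary := ⟨rfl⟩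

/-- The Haar probability measure on `U(ℂ² ⊗ ℂ²)`: the Haar measure that gives mass one to the
whole group. -/
def unitaryHaar : Measure TwoQubitUnitary :=
  Measure.haarMeasure (⊤ : TopologicalSpace.PositiveCompacts TwoQubitUnitary)

/-! ### Reduced states -/

/-- The space of `2 × 2` complex matrices carries its Borel σ-algebra. -/
instance qubitMatrix_measurableSpace : MeasurableSpace (Matrix (Fin 2) (Fin 2) ℂ) :=
  borel (Matrix (Fin 2) (Fin 2) ℂ)

instance qubitMatrix_borelSpace : BorelSpace (Matrix (Fin 2) (Fin 2) ℂ) := ⟨rfl⟩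

/-- The rank-one operator `|ψ⟩⟨ψ|` on `ℂ² ⊗ ℂ²`. -/
def pureProjector (ψ : TwoQubitIndex → ℂ) : Matrix TwoQubitIndex TwoQubitIndex ℂ :=
  Matrix.vecMulVec ψ (star ψ)

/-- The partial trace over the second tensor factor of `ℂ² ⊗ ℂ²`. -/
def partialTrace (M : Matrix TwoQubitIndex TwoQubitIndex ℂ) : Matrix (Fin 2) (Fin 2) ℂ :=
  Matrix.of fun i j => ∑ k : Fin 2, M (i, k) (j, k)

/-- The reduced state of the pure state `U|Φ⟩`. -/
def reducedState (Φ : EuclideanSpace ℂ TwoQubitIndex) (U : TwoQubitUnitary) :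
    Matrix (Fin 2) (Fin 2) ℂ :=
  partialTrace (pureProjector ((U : Matrix TwoQubitIndex TwoQubitIndex ℂ) *ᵥ Φ.ofLp))

/-- The law `μ` of the reduced state `ρ` of the Haar-random pure state `U|Φ⟩` (with `Φ` a fixed
unit vector). It is carried by the set of density matrices. -/
def reducedStateLaw (Φ : EuclideanSpace ℂ TwoQubitIndex) : Measure (Matrix (Fin 2) (Fin 2) ℂ) :=
  unitaryHaar.map (reducedState Φ)

/-! ### Qubit observables and their mean values -/

/-- The Pauli matrices `σ₁, σ₂, σ₃`. -/
def pauli : Fin 3 → Matrix (Fin 2) (Fin 2) ℂ :=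
  ![!![0, 1; 1, 0], !![0, -Complex.I; Complex.I, 0], !![1, 0; 0, -1]]

/-- The qubit observable `a₀ 𝟙 + a · σ`. -/
def qubitObservable (a₀ : ℝ) (a : EuclideanSpace ℝ (Fin 3)) : Matrix (Fin 2) (Fin 2) ℂ :=
  (a₀ : ℂ) • (1 : Matrix (Fin 2) (Fin 2) ℂ) + ∑ k : Fin 3, ((a k : ℝ) : ℂ) • pauli k

/-- The mean value `⟨A⟩_ρ = Tr(A ρ)`. The trace is a real number for Hermitian `A` and `ρ`. -/
def meanValue (A ρ : Matrix (Fin 2) (Fin 2) ℂ) : ℝ := (Matrix.trace (A * ρ)).re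

/-- The joint law of the mean values of a finite tuple of observables `A` in the reduced state
of the Haar-random pure state `U|Φ⟩`. -/
def meanValueLaw {n : ℕ} (Φ : EuclideanSpace ℂ TwoQubitIndex)
    (A : Fin n → Matrix (Fin 2) (Fin 2) ℂ) : Measure (Fin n → ℝ) :=
  (reducedStateLaw Φ).map fun ρ i => meanValue (A i) ρ

/-! ### The explicit densities -/

/-- The Heaviside function. -/
def heaviside (x : ℝ) : ℝ := if 0 ≤ x then 1 else 0

/-- `ω(x) = √((x - a₀) T⁻¹ (x - a₀)ᵀ)`, where `T` is the Gram matrix of the vectors `a i`. -/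
def omega {n : ℕ} (a₀ : Fin n → ℝ) (a : Fin n → EuclideanSpace ℝ (Fin 3)) (x : Fin n → ℝ) : ℝ :=
  √((x - a₀) ⬝ᵥ ((Matrix.gram ℝ a)⁻¹ *ᵥ (x - a₀)))

/-- The density of one mean value, in terms of the eigenvalues `a₀ ∓ |a|` of the observable. -/
def meanDensityOne (a₀ : ℝ) (a : EuclideanSpace ℝ (Fin 3)) (r : ℝ) : ℝ :=
  let l₁ := a₀ - ‖a‖
  let l₂ := a₀ + ‖a‖
  6 / (l₂ - l₁) ^ 3 * ((r - l₁) * (l₂ - r)) * (heaviside (r - l₁) - heaviside (r - l₂))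

/-- The joint density of two mean values. -/
def meanDensityTwo (a₀ : Fin 2 → ℝ) (a : Fin 2 → EuclideanSpace ℝ (Fin 3)) (x : Fin 2 → ℝ) : ℝ :=
  3 / (2 * Real.pi * √(Matrix.gram ℝ a).det) * √(1 - omega a₀ a x ^ 2) *
    heaviside (1 - omega a₀ a x)

/-- The joint density of three mean values. -/
def meanDensityThree (a₀ : Fin 3 → ℝ) (a : Fin 3 → EuclideanSpace ℝ (Fin 3))
    (x : Fin 3 → ℝ) : ℝ :=
  3 * (1 + Real.sign (1 - omega a₀ a x)) / (8 * Real.pi * √(Matrix.gram ℝ a).det)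

end

open scoped ENNReal Kronecker

/-- The squared Euclidean norm of a vector of `ℂ²`. -/
def sqNorm (u : Fin 2 → ℂ) : ℝ := ∑ k, Complex.normSq (u k)

lemma sqNorm_nonneg (u : Fin 2 → ℂ) : 0 ≤ sqNorm u :=
  Finset.sum_nonneg fun _ _ => Complex.normSq_nonneg _

lemma continuous_sqNorm : Continuous sqNorm := by
  unfold sqNorm
  exact continuous_finsetSum _ fun k _ => Complex.continuous_normSq.comp (continuous_apply k)

lemma sqNorm_smul (r : ℝ) (u : Fin 2 → ℂ) : sqNorm (r • u) = r ^ 2 * sqNorm u := by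
  simp [sqNorm, Complex.normSq_mul, Complex.normSq_ofReal, pow_two, mul_add]

lemma normSq_le_sqNorm (u : Fin 2 → ℂ) (k : Fin 2) : Complex.normSq (u k) ≤ sqNorm u :=
  Finset.single_le_sum (f := fun k => Complex.normSq (u k))
    (fun _ _ => Complex.normSq_nonneg _) (Finset.mem_univ k)

lemma sqNorm_eq_zero {u : Fin 2 → ℂ} : sqNorm u = 0 ↔ u = 0 := by
  constructor
  · intro h
    ext k
    have := normSq_le_sqNorm u k
    exact Complex.normSq_eq_zero.mp (le_antisymm (h ▸ this) (Complex.normSq_nonneg _))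
  · rintro rfl
    simp [sqNorm]

lemma norm_le_one_of_sqNorm_le_one {u : Fin 2 → ℂ} (h : sqNorm u ≤ 1) : ‖u‖ ≤ 1 := by
  refine (pi_norm_le_iff_of_nonneg zero_le_one).2 fun k => ?_
  have h1 := (normSq_le_sqNorm u k).trans h
  rw [Complex.normSq_eq_norm_sq] at h1
  nlinarith [norm_nonneg (u k)]

lemma volume_sqNorm_le_one_ne_zero : volume {u : Fin 2 → ℂ | sqNorm u ≤ 1} ≠ 0 := by
  have hO : IsOpen {u : Fin 2 → ℂ | sqNorm u < 1} := isOpen_lt continuous_sqNorm continuous_const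
  have := hO.measure_pos volume ⟨0, by simp [sqNorm]⟩
  exact (this.trans_le (measure_mono fun u (hu : sqNorm u < 1) => hu.le)).ne'

lemma volume_sqNorm_le_one_ne_top : volume {u : Fin 2 → ℂ | sqNorm u ≤ 1} ≠ ∞ := by
  refine ((measure_mono fun u (hu : sqNorm u ≤ 1) => ?_).trans_lt
    (measure_closedBall_lt_top (x := (0 : Fin 2 → ℂ)) (r := 1))).ne
  simpa using norm_le_one_of_sqNorm_le_one hu

lemma volume_sqNorm_le {t : ℝ} (ht : 0 ≤ t) :
    volume {u : Fin 2 → ℂ | sqNorm u ≤ t} =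
      ENNReal.ofReal (t ^ 2) * volume {u : Fin 2 → ℂ | sqNorm u ≤ 1} := by
  rcases ht.eq_or_lt with rfl | ht
  · have : {u : Fin 2 → ℂ | sqNorm u ≤ 0} = {0} := by
      ext u
      simp [← sqNorm_eq_zero, le_antisymm_iff, sqNorm_nonneg]
    simp [this]
  · have hs : {u : Fin 2 → ℂ | sqNorm u ≤ t} = (fun u => (√t)⁻¹ • u) ⁻¹' {u | sqNorm u ≤ 1} := by
      ext u
      simp only [Set.mem_ofPred_eq, Set.mem_preimage, sqNorm_smul, inv_pow, Real.sq_sqrt ht.le]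
      rw [inv_mul_le_iff₀ ht, mul_one]
    have hd : Module.finrank ℝ (Fin 2 → ℂ) = 4 := by
      simp [Module.finrank_pi_fintype]
    rw [hs, Measure.addHaar_preimage_smul _ (by positivity), hd]
    congr 2
    rw [inv_pow, inv_inv, abs_of_nonneg (by positivity)]
    nlinarith [Real.sq_sqrt ht.le]

lemma setLIntegral_Iic_ofReal {s : ℝ} (hs : 0 ≤ s) :
    ∫⁻ t in Set.Iic s, ENNReal.ofReal t = ENNReal.ofReal (s ^ 2 / 2) := by
  rw [← Set.Iic_union_Ioc_eq_Iic hs, lintegral_union measurableSet_Ioc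
    (Set.Iic_disjoint_Ioc le_rfl), setLIntegral_congr_fun (g := fun _ => 0) measurableSet_Iic
    (fun t ht => ENNReal.ofReal_of_nonpos ht), lintegral_zero, zero_add,
    ← ofReal_integral_eq_lintegral_ofReal, ← intervalIntegral.integral_of_le hs]
  · simp
  · exact (intervalIntegrable_iff_integrableOn_Ioc_of_le hs).1
      (continuous_id.intervalIntegrable _ _)
  · exact (ae_restrict_iff' measurableSet_Ioc).2 (Filter.Eventually.of_forall fun t ht => ht.1.le)

lemma exists_map_sqNorm : ∃ c : ℝ≥0∞, c ≠ 0 ∧ c ≠ ∞ ∧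
    (volume : Measure (Fin 2 → ℂ)).map sqNorm =
      c • (volume : Measure ℝ).withDensity ENNReal.ofReal := by
  refine ⟨2 * volume {u : Fin 2 → ℂ | sqNorm u ≤ 1},
    mul_ne_zero two_ne_zero volume_sqNorm_le_one_ne_zero,
    ENNReal.mul_ne_top (by simp) volume_sqNorm_le_one_ne_top, ?_⟩
  have hm (s : ℝ) : (volume : Measure (Fin 2 → ℂ)).map sqNorm (Set.Iic s) =
      volume {u : Fin 2 → ℂ | sqNorm u ≤ s} :=
    Measure.map_apply continuous_sqNorm.measurable measurableSet_Iic
  refine Measure.ext_of_generateFrom_of_iUnion (Set.range Set.Iic) (fun n : ℕ => Set.Iic (n : ℝ))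
    ((BorelSpace.measurable_eq (α := ℝ)).trans (borel_eq_generateFrom_Iic ℝ)) isPiSystem_Iic
    (Set.iUnion_eq_univ_iff.2 fun x => exists_nat_ge x) (fun n => ⟨n, rfl⟩) (fun n => ?_) ?_
  · rw [hm, volume_sqNorm_le n.cast_nonneg]
    exact ENNReal.mul_ne_top ENNReal.ofReal_ne_top volume_sqNorm_le_one_ne_top
  · rintro _ ⟨s, rfl⟩
    rw [hm, Measure.smul_apply, withDensity_apply _ measurableSet_Iic, smul_eq_mul]
    rcases le_or_gt 0 s with hs | hs
    · rw [setLIntegral_Iic_ofReal hs, volume_sqNorm_le hs, mul_right_comm,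
        ENNReal.ofReal_div_of_pos two_pos, ENNReal.ofReal_ofNat,
        ENNReal.mul_div_cancel two_ne_zero (by simp)]
    · have : {u : Fin 2 → ℂ | sqNorm u ≤ s} = ∅ :=
        Set.eq_empty_of_forall_notMem fun u hu => absurd (sqNorm_nonneg u) (hu.trans_lt hs).not_ge
      rw [this, setLIntegral_congr_fun (g := fun _ => 0) measurableSet_Iic
        (fun t ht => ENNReal.ofReal_of_nonpos (le_trans ht hs.le))]
      simp

/-- Change of variables `(p, q) = (t w, (1 - t) w)` in the plane. -/
lemma lintegral_lintegral_eq_polar_simplex {G : ℝ → ℝ → ℝ≥0∞}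
    (hG : Measurable fun z : ℝ × ℝ => G z.1 z.2) :
    ∫⁻ p, ∫⁻ q, G p q = ∫⁻ t, ∫⁻ w, ENNReal.ofReal |w| * G (t * w) ((1 - t) * w) := by
  have h1 : Measurable fun z : ℝ × ℝ => G z.2 (z.1 - z.2) :=
    hG.comp (measurable_snd.prodMk (measurable_fst.sub measurable_snd))
  have h2 : Measurable fun z : ℝ × ℝ =>
      ENNReal.ofReal |z.1| * G (z.2 * z.1) ((1 - z.2) * z.1) := by
    refine (by fun_prop : Measurable fun z : ℝ × ℝ => ENNReal.ofReal |z.1|).mul ?_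
    exact hG.comp (by fun_prop : Measurable fun z : ℝ × ℝ => (z.2 * z.1, (1 - z.2) * z.1))
  calc ∫⁻ p, ∫⁻ q, G p q = ∫⁻ p, ∫⁻ w, G p (w - p) := by
        refine lintegral_congr fun p => ?_
        exact (lintegral_sub_right_eq_self (fun q => G p q) p).symm
    _ = ∫⁻ w, ∫⁻ p, G p (w - p) :=
        lintegral_lintegral_swap (h1.comp measurable_swap).aemeasurable
    _ = ∫⁻ w, ∫⁻ t, ENNReal.ofReal |w| * G (t * w) ((1 - t) * w) := by
        refine lintegral_congr_ae ?_
        filter_upwards [Measure.ae_ne volume (0 : ℝ)] with w hw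
        have hm : Measurable fun p => G p (w - p) :=
          hG.comp (measurable_id.prodMk (measurable_const.sub measurable_id))
        rw [lintegral_const_mul]
        · conv_lhs => rw [← Real.smul_map_volume_mul_right hw]
          rw [lintegral_smul_measure, lintegral_map hm (by fun_prop), smul_eq_mul]
          simp only [sub_mul, one_mul]
        · exact hG.comp (by fun_prop : Measurable fun t : ℝ => (t * w, (1 - t) * w))
    _ = _ := lintegral_lintegral_swap h2.aemeasurable

lemma ofReal_mul_ofReal_one_sub_mul (t w : ℝ) :
    ENNReal.ofReal |w| * (ENNReal.ofReal (t * w) * ENNReal.ofReal ((1 - t) * w)) =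
      ENNReal.ofReal (w ^ 3) * ENNReal.ofReal (t * (1 - t)) := by
  rcases le_or_gt w 0 with hw | hw
  · rw [ENNReal.ofReal_of_nonpos (p := w ^ 3) (by nlinarith [sq_nonneg w]), zero_mul]
    rcases le_or_gt 0 t with ht | ht
    · rw [ENNReal.ofReal_of_nonpos (p := t * w) (by nlinarith), zero_mul, mul_zero]
    · rw [ENNReal.ofReal_of_nonpos (p := (1 - t) * w) (by nlinarith), mul_zero, mul_zero]
  · rcases le_or_gt t 0 with ht | ht
    · rw [ENNReal.ofReal_of_nonpos (p := t * w) (by nlinarith),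
        ENNReal.ofReal_of_nonpos (p := t * (1 - t)) (by nlinarith)]
      simp
    · rw [← ENNReal.ofReal_mul (by positivity), ← ENNReal.ofReal_mul (by positivity),
        ← ENNReal.ofReal_mul (by positivity), abs_of_pos hw]
      congr 1
      ring

lemma lintegral_prod_sqNorm : ∃ c : ℝ≥0∞, c ≠ 0 ∧ c ≠ ∞ ∧
    ∀ H : ℝ → ℝ → ℝ≥0∞, (Measurable fun z : ℝ × ℝ => H z.1 z.2) →
      ∫⁻ x : (Fin 2 → ℂ) × (Fin 2 → ℂ), H (sqNorm x.1) (sqNorm x.2) =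
        c * ∫⁻ p, ∫⁻ q, ENNReal.ofReal p * ENNReal.ofReal q * H p q := by
  obtain ⟨c, h0, h1, hc⟩ := exists_map_sqNorm
  have key (f : ℝ → ℝ≥0∞) (hf : Measurable f) :
      ∫⁻ u : Fin 2 → ℂ, f (sqNorm u) = c * ∫⁻ p, ENNReal.ofReal p * f p := by
    rw [← lintegral_map hf continuous_sqNorm.measurable, hc, lintegral_smul_measure,
      lintegral_withDensity_eq_lintegral_mul _ ENNReal.measurable_ofReal hf, smul_eq_mul]
    rfl
  refine ⟨c * c, mul_ne_zero h0 h0, ENNReal.mul_ne_top h1 h1, fun H hH => ?_⟩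
  have hN := continuous_sqNorm.measurable
  have hH' : Measurable fun x : (Fin 2 → ℂ) × (Fin 2 → ℂ) => H (sqNorm x.1) (sqNorm x.2) :=
    hH.comp ((hN.comp measurable_fst).prodMk (hN.comp measurable_snd))
  have hq : Measurable fun z : ℝ × ℝ => ENNReal.ofReal z.2 * H z.1 z.2 := by fun_prop
  have hp : Measurable fun p => ∫⁻ q, ENNReal.ofReal p * ENNReal.ofReal q * H p q :=
    Measurable.lintegral_prod_right'
      (f := fun z : ℝ × ℝ => ENNReal.ofReal z.1 * ENNReal.ofReal z.2 * H z.1 z.2) (by fun_prop)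
  rw [Measure.volume_eq_prod, lintegral_prod _ hH'.aemeasurable]
  simp_rw [fun u : Fin 2 → ℂ => key (H (sqNorm u)) (hH.comp measurable_prodMk_left)]
  rw [key (fun p => c * ∫⁻ q, ENNReal.ofReal q * H p q) (hq.lintegral_prod_right'.const_mul c),
    mul_assoc]
  congr 1
  rw [← lintegral_const_mul _ hp]
  refine lintegral_congr fun p => ?_
  simp_rw [mul_assoc]
  rw [lintegral_const_mul _ (by exact hq.comp measurable_prodMk_left)]
  ring

lemma exists_lintegral_ball_ratio : ∃ C : ℝ≥0∞, C ≠ 0 ∧ C ≠ ∞ ∧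
    ∀ g : ℝ → ℝ≥0∞, Measurable g →
      ∫⁻ x : (Fin 2 → ℂ) × (Fin 2 → ℂ), (Set.Iio (1 : ℝ)).indicator 1 (sqNorm x.1 + sqNorm x.2) *
          g ((sqNorm x.1 - sqNorm x.2) / (sqNorm x.1 + sqNorm x.2)) =
        C * ∫⁻ z, ENNReal.ofReal (1 - z ^ 2) * g z := by
  obtain ⟨c, h0, h1, hc⟩ := lintegral_prod_sqNorm
  have hind : Measurable ((Set.Iio (1 : ℝ)).indicator (1 : ℝ → ℝ≥0∞)) :=
    measurable_one.indicator measurableSet_Iio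
  have hKm : Measurable fun w : ℝ =>
      ENNReal.ofReal (w ^ 3) * (Set.Iio (1 : ℝ)).indicator (1 : ℝ → ℝ≥0∞) w := by fun_prop
  set K : ℝ≥0∞ := ∫⁻ w, ENNReal.ofReal (w ^ 3) * (Set.Iio (1 : ℝ)).indicator 1 w with hK
  have hK0 : K ≠ 0 := by
    intro h
    rw [hK, lintegral_eq_zero_iff hKm] at h
    have h2 : volume (Set.Ioo (0 : ℝ) 1) = 0 := by
      refine measure_mono_null (fun w hw => ?_) (ae_iff.1 h)
      have : 0 < w ^ 3 := pow_pos hw.1 3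
      simpa [Set.indicator_of_mem (show w ∈ Set.Iio 1 from hw.2)] using ⟨this, hw.2⟩
    simp at h2
  have hK1 : K ≠ ∞ := by
    refine (lt_of_le_of_lt (lintegral_mono (g := (Set.Icc (0 : ℝ) 1).indicator 1) fun w => ?_)
      ?_).ne
    · by_cases hw : w < 1
      · rcases le_or_gt w 0 with h | h
        · rw [ENNReal.ofReal_of_nonpos (by nlinarith [sq_nonneg w]), zero_mul]
          exact zero_le
        · rw [Set.indicator_of_mem (show w ∈ Set.Iio 1 from hw),
            Set.indicator_of_mem (show w ∈ Set.Icc 0 1 from ⟨h.le, hw.le⟩), Pi.one_apply,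
            mul_one, ENNReal.ofReal_le_one]
          exact pow_le_one₀ h.le hw.le
      · rw [Set.indicator_of_notMem (show w ∉ Set.Iio 1 from hw), mul_zero]
        exact zero_le
    · rw [lintegral_indicator_one measurableSet_Icc]
      simp
  have hq : ENNReal.ofReal (1 / 4) ≠ 0 := by simp
  have hh : ENNReal.ofReal |(2 : ℝ)⁻¹| ≠ 0 := by simp
  refine ⟨c * (K * (ENNReal.ofReal |(2 : ℝ)⁻¹| * ENNReal.ofReal (1 / 4))),
    mul_ne_zero h0 (mul_ne_zero hK0 (mul_ne_zero hh hq)),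
    ENNReal.mul_ne_top h1 (ENNReal.mul_ne_top hK1
      (ENNReal.mul_ne_top ENNReal.ofReal_ne_top ENNReal.ofReal_ne_top)), fun g hg => ?_⟩
  rw [hc (fun p q => (Set.Iio (1 : ℝ)).indicator 1 (p + q) * g ((p - q) / (p + q)))
    ((hind.comp (by fun_prop)).mul (hg.comp (by fun_prop)))]
  rw [lintegral_lintegral_eq_polar_simplex ((by fun_prop : Measurable fun z : ℝ × ℝ =>
    ENNReal.ofReal z.1 * ENNReal.ofReal z.2).mul
      ((hind.comp (by fun_prop)).mul (hg.comp (by fun_prop)))), mul_assoc, mul_assoc]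
  congr 1
  have hpt (t w : ℝ) : ENNReal.ofReal |w| * (ENNReal.ofReal (t * w) *
      ENNReal.ofReal ((1 - t) * w) * ((Set.Iio (1 : ℝ)).indicator 1 (t * w + (1 - t) * w) *
        g ((t * w - (1 - t) * w) / (t * w + (1 - t) * w)))) =
      ENNReal.ofReal (w ^ 3) * (Set.Iio (1 : ℝ)).indicator 1 w *
        (ENNReal.ofReal (t * (1 - t)) * g (2 * t - 1)) := by
    rcases eq_or_ne w 0 with rfl | hw
    · simp
    · have e1 : t * w + (1 - t) * w = w := by ring
      have e2 : (t * w - (1 - t) * w) / w = 2 * t - 1 := by field_simp; ring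
      rw [e1, e2, ← mul_assoc, ofReal_mul_ofReal_one_sub_mul]
      ring
  simp_rw [hpt, lintegral_mul_const _ hKm]
  rw [lintegral_const_mul _ (by fun_prop)]
  congr 1
  have e3 (t : ℝ) : ENNReal.ofReal (t * (1 - t)) * g (2 * t - 1) =
      (fun z => ENNReal.ofReal (1 / 4) * (ENNReal.ofReal (1 - z ^ 2) * g z)) (2 * t - 1) := by
    simp only [← mul_assoc]
    rw [← ENNReal.ofReal_mul (by norm_num)]
    congr 2
    ring
  have hmz : Measurable fun z : ℝ => ENNReal.ofReal (1 / 4) * (ENNReal.ofReal (1 - z ^ 2) * g z) := by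
    fun_prop
  simp_rw [e3]
  rw [← lintegral_map (f := fun z => ENNReal.ofReal (1 / 4) * (ENNReal.ofReal (1 - z ^ 2) * g z))
    (g := fun t : ℝ => 2 * t - 1) hmz (by fun_prop)]
  have hmap : (volume : Measure ℝ).map (fun t : ℝ => 2 * t - 1) =
      ENNReal.ofReal |(2 : ℝ)⁻¹| • volume := by
    have := (measurePreserving_sub_right (volume : Measure ℝ) 1).map_eq
    rw [show (fun t : ℝ => 2 * t - 1) = (fun t => t - 1) ∘ fun t => 2 * t from rfl,
      ← Measure.map_map (by fun_prop) (by fun_prop), Real.map_volume_mul_left two_ne_zero,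
      Measure.map_smul, this]
  rw [hmap, lintegral_smul_measure, lintegral_const_mul _ (by fun_prop), smul_eq_mul, mul_assoc]

instance unitaryHaar_isHaarMeasure : unitaryHaar.IsHaarMeasure := by
  unfold unitaryHaar
  infer_instance

instance unitaryHaar_isProbabilityMeasure : IsProbabilityMeasure unitaryHaar :=
  ⟨by simpa [unitaryHaar] using
    Measure.haarMeasure_self (K₀ := (⊤ : TopologicalSpace.PositiveCompacts TwoQubitUnitary))⟩

instance unitaryHaar_isMulRightInvariant : unitaryHaar.IsMulRightInvariant where
  map_mul_right_eq_self g := by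
    have : IsProbabilityMeasure (unitaryHaar.map (· * g)) :=
      Measure.isProbabilityMeasure_map (by fun_prop)
    exact Measure.isHaarMeasure_eq_of_isProbabilityMeasure _ _

instance volume_blocks_isAddHaarMeasure :
    (volume : Measure ((Fin 2 → ℂ) × (Fin 2 → ℂ))).IsAddHaarMeasure :=
  Measure.prod.instIsAddHaarMeasure _ _

/-- A vector of `ℂ² ⊗ ℂ²` as the pair of its blocks with respect to the first factor. -/
def blockEquiv : ((Fin 2 → ℂ) × (Fin 2 → ℂ)) ≃ₗ[ℝ] (TwoQubitIndex → ℂ) where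
  toFun x i := if i.1 = 0 then x.1 i.2 else x.2 i.2
  invFun ψ := (fun k => ψ (0, k), fun k => ψ (1, k))
  map_add' x y := by
    ext ⟨i, k⟩
    fin_cases i <;> simp
  map_smul' c x := by
    ext ⟨i, k⟩
    fin_cases i <;> simp
  left_inv x := by simp
  right_inv ψ := by
    ext ⟨i, k⟩
    fin_cases i <;> simp

/-- The squared Euclidean norm of a vector of `ℂ² ⊗ ℂ²`. -/
def totalSqNorm (ψ : TwoQubitIndex → ℂ) : ℝ := ∑ i, Complex.normSq (ψ i)

lemma totalSqNorm_eq_add (ψ : TwoQubitIndex → ℂ) :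
    totalSqNorm ψ = sqNorm (blockEquiv.symm ψ).1 + sqNorm (blockEquiv.symm ψ).2 := by
  rw [totalSqNorm, Fintype.sum_prod_type, Fin.sum_univ_two]
  rfl

lemma totalSqNorm_blockEquiv (x : (Fin 2 → ℂ) × (Fin 2 → ℂ)) :
    totalSqNorm (blockEquiv x) = sqNorm x.1 + sqNorm x.2 := by
  rw [totalSqNorm_eq_add, LinearEquiv.symm_apply_apply]

lemma ofReal_totalSqNorm (ψ : TwoQubitIndex → ℂ) : (totalSqNorm ψ : ℂ) = star ψ ⬝ᵥ ψ := by
  simp [totalSqNorm, dotProduct, Complex.normSq_eq_conj_mul_self]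

lemma totalSqNorm_ofLp (Φ : EuclideanSpace ℂ TwoQubitIndex) : totalSqNorm Φ.ofLp = ‖Φ‖ ^ 2 := by
  simp [EuclideanSpace.norm_sq_eq, totalSqNorm, Complex.normSq_eq_norm_sq]

lemma totalSqNorm_mulVec (U : TwoQubitUnitary) (ψ : TwoQubitIndex → ℂ) :
    totalSqNorm ((U : Matrix TwoQubitIndex TwoQubitIndex ℂ) *ᵥ ψ) = totalSqNorm ψ := by
  have h : star (U : Matrix TwoQubitIndex TwoQubitIndex ℂ) * U = 1 :=
    Unitary.star_mul_self_of_mem U.2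
  apply Complex.ofReal_injective
  rw [ofReal_totalSqNorm, ofReal_totalSqNorm, star_mulVec, ← dotProduct_mulVec, mulVec_mulVec,
    ← star_eq_conjTranspose, h, one_mulVec]

lemma totalSqNorm_smul (r : ℝ) (ψ : TwoQubitIndex → ℂ) :
    totalSqNorm (r • ψ) = r ^ 2 * totalSqNorm ψ := by
  simp [totalSqNorm, Finset.mul_sum, Complex.normSq_mul, Complex.normSq_ofReal, pow_two]

lemma continuous_blockEquiv : Continuous blockEquiv :=
  LinearMap.continuous_of_finiteDimensional blockEquiv.toLinearMap

lemma continuous_blockEquiv_symm : Continuous blockEquiv.symm :=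
  LinearMap.continuous_of_finiteDimensional blockEquiv.symm.toLinearMap

/-- The action of a unitary on the pairs of blocks. -/
noncomputable def blockAction (U : TwoQubitUnitary) :
    ((Fin 2 → ℂ) × (Fin 2 → ℂ)) →ₗ[ℝ] (Fin 2 → ℂ) × (Fin 2 → ℂ) :=
  blockEquiv.symm.toLinearMap ∘ₗ
    ((U : Matrix TwoQubitIndex TwoQubitIndex ℂ).mulVecLin.restrictScalars ℝ) ∘ₗ
      blockEquiv.toLinearMap

lemma blockEquiv_blockAction (U : TwoQubitUnitary) (x : (Fin 2 → ℂ) × (Fin 2 → ℂ)) :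
    blockEquiv (blockAction U x) =
      (U : Matrix TwoQubitIndex TwoQubitIndex ℂ) *ᵥ blockEquiv x := by
  simp [blockAction]

lemma continuous_blockAction (U : TwoQubitUnitary) : Continuous (blockAction U) :=
  LinearMap.continuous_of_finiteDimensional _

lemma blockAction_inv_comp (U : TwoQubitUnitary) :
    blockAction U⁻¹ ∘ₗ blockAction U = LinearMap.id := by
  ext1 <;>
  · refine LinearMap.ext fun x => blockEquiv.injective ?_
    simp only [LinearMap.comp_apply]
    rw [blockEquiv_blockAction, blockEquiv_blockAction, mulVec_mulVec, ← Submonoid.coe_mul]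
    simp

lemma measurePreserving_blockAction (U : TwoQubitUnitary) :
    MeasurePreserving (blockAction U) volume volume := by
  have hdet : LinearMap.det (blockAction U) ≠ 0 := by
    intro h
    have := congrArg LinearMap.det (blockAction_inv_comp U)
    rw [LinearMap.det_comp, h, mul_zero, LinearMap.det_id] at this
    exact zero_ne_one this
  set B : Set ((Fin 2 → ℂ) × (Fin 2 → ℂ)) := {x | sqNorm x.1 + sqNorm x.2 < 1} with hB
  have hBU : blockAction U ⁻¹' B = B := by
    ext x
    simp only [hB, Set.mem_preimage, Set.mem_ofPred_eq, ← totalSqNorm_blockEquiv,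
      blockEquiv_blockAction, totalSqNorm_mulVec]
  have hO : IsOpen B := isOpen_lt ((continuous_sqNorm.comp continuous_fst).add
    (continuous_sqNorm.comp continuous_snd)) continuous_const
  have hB0 : volume B ≠ 0 := (hO.measure_pos volume ⟨0, by simp [hB, sqNorm]⟩).ne'
  have hB1 : volume B ≠ ∞ := by
    refine ((measure_mono fun x hx => ?_).trans_lt
      (measure_closedBall_lt_top (x := (0 : (Fin 2 → ℂ) × (Fin 2 → ℂ))) (r := 1))).ne
    replace hx : sqNorm x.1 + sqNorm x.2 < 1 := hx
    rw [mem_closedBall_zero_iff, Prod.norm_def]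
    exact max_le (norm_le_one_of_sqNorm_le_one (by linarith [sqNorm_nonneg x.2]))
      (norm_le_one_of_sqNorm_le_one (by linarith [sqNorm_nonneg x.1]))
  have h1 := Measure.addHaar_preimage_linearMap volume hdet B
  rw [hBU] at h1
  refine ⟨(continuous_blockAction U).measurable, ?_⟩
  rw [Measure.map_linearMap_addHaar_eq_smul_addHaar _ hdet]
  rw [(ENNReal.mul_left_inj hB0 hB1).1 (h1.symm.trans (one_mul _).symm), one_smul]

lemma exists_unitary_mulVec_single {ψ : TwoQubitIndex → ℂ} (hψ : totalSqNorm ψ = 1) :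
    ∃ W : TwoQubitUnitary,
      (W : Matrix TwoQubitIndex TwoQubitIndex ℂ) *ᵥ Pi.single (0, 0) 1 = ψ := by
  have hn : ‖WithLp.toLp 2 ψ‖ = 1 := by
    have := totalSqNorm_ofLp (WithLp.toLp 2 ψ)
    simp only [hψ] at this
    nlinarith [norm_nonneg (WithLp.toLp 2 ψ)]
  obtain ⟨b, hb⟩ := Orthonormal.exists_orthonormalBasis_extension_of_card_eq
    (𝕜 := ℂ) (E := EuclideanSpace ℂ TwoQubitIndex) (ι := TwoQubitIndex) (by simp)
    (v := fun _ => WithLp.toLp 2 ψ) (s := {(0, 0)})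
    (by
      refine ⟨fun i => hn, fun i j hij => absurd (Subsingleton.elim i j) hij⟩)
  refine ⟨⟨_, (EuclideanSpace.basisFun TwoQubitIndex ℂ).toMatrix_orthonormalBasis_mem_unitary b⟩,
    ?_⟩
  ext i
  simp [Module.Basis.toMatrix_apply, hb]

theorem lintegral_unitaryHaar_mul {Φ : TwoQubitIndex → ℂ} (hΦ : totalSqNorm Φ = 1)
    {G : (TwoQubitIndex → ℂ) → ℝ≥0∞} (hG : Measurable G)
    (hhom : ∀ (r : ℝ) (ψ : TwoQubitIndex → ℂ), 0 < r → G (r • ψ) = G ψ) :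
    (∫⁻ U : TwoQubitUnitary, G ((U : Matrix TwoQubitIndex TwoQubitIndex ℂ) *ᵥ Φ) ∂unitaryHaar) *
        ∫⁻ x : (Fin 2 → ℂ) × (Fin 2 → ℂ),
          (Set.Iio (1 : ℝ)).indicator 1 (sqNorm x.1 + sqNorm x.2) =
      ∫⁻ x : (Fin 2 → ℂ) × (Fin 2 → ℂ),
        (Set.Iio (1 : ℝ)).indicator 1 (sqNorm x.1 + sqNorm x.2) * G (blockEquiv x) := by
  have hind : Measurable fun x : (Fin 2 → ℂ) × (Fin 2 → ℂ) =>
      (Set.Iio (1 : ℝ)).indicator (1 : ℝ → ℝ≥0∞) (sqNorm x.1 + sqNorm x.2) :=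
    (measurable_one.indicator measurableSet_Iio).comp
      ((continuous_sqNorm.measurable.comp measurable_fst).add
        (continuous_sqNorm.measurable.comp measurable_snd))
  have hUm : Measurable fun z : TwoQubitUnitary × ((Fin 2 → ℂ) × (Fin 2 → ℂ)) =>
      (z.1 : Matrix TwoQubitIndex TwoQubitIndex ℂ) *ᵥ blockEquiv z.2 :=
    ((continuous_subtype_val.comp continuous_fst).matrix_mulVec
      (continuous_blockEquiv.comp continuous_snd)).measurable
  have hsingle {ψ : TwoQubitIndex → ℂ} (hψ : totalSqNorm ψ = 1) :
      ∫⁻ U : TwoQubitUnitary, G ((U : Matrix TwoQubitIndex TwoQubitIndex ℂ) *ᵥ ψ) ∂unitaryHaar =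
        ∫⁻ U : TwoQubitUnitary, G ((U : Matrix TwoQubitIndex TwoQubitIndex ℂ) *ᵥ
          Pi.single (0, 0) 1) ∂unitaryHaar := by
    obtain ⟨W, rfl⟩ := exists_unitary_mulVec_single hψ
    rw [← lintegral_mul_right_eq_self (μ := unitaryHaar) (fun U : TwoQubitUnitary =>
      G ((U : Matrix TwoQubitIndex TwoQubitIndex ℂ) *ᵥ Pi.single (0, 0) 1)) W]
    simp only [mulVec_mulVec, Submonoid.coe_mul]
  have hconst (x : (Fin 2 → ℂ) × (Fin 2 → ℂ)) (hx : x ≠ 0) :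
      ∫⁻ U : TwoQubitUnitary, G ((U : Matrix TwoQubitIndex TwoQubitIndex ℂ) *ᵥ blockEquiv x)
          ∂unitaryHaar =
        ∫⁻ U : TwoQubitUnitary, G ((U : Matrix TwoQubitIndex TwoQubitIndex ℂ) *ᵥ Φ)
          ∂unitaryHaar := by
    have hpos : 0 < totalSqNorm (blockEquiv x) := by
      rw [totalSqNorm_blockEquiv]
      have h1 := sqNorm_nonneg x.1
      have h2 := sqNorm_nonneg x.2
      refine (add_nonneg h1 h2).lt_of_ne' fun h => hx ?_
      exact Prod.ext (sqNorm_eq_zero.1 (by linarith)) (sqNorm_eq_zero.1 (by linarith))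
    have hunit : totalSqNorm ((√(totalSqNorm (blockEquiv x)))⁻¹ • blockEquiv x) = 1 := by
      rw [totalSqNorm_smul, inv_pow, Real.sq_sqrt hpos.le, inv_mul_cancel₀ hpos.ne']
    rw [hsingle hΦ, ← hsingle hunit]
    refine lintegral_congr fun U => ?_
    rw [mulVec_smul, hhom _ _ (by positivity)]
  calc _ = ∫⁻ x : (Fin 2 → ℂ) × (Fin 2 → ℂ), ∫⁻ U : TwoQubitUnitary,
        (Set.Iio (1 : ℝ)).indicator 1 (sqNorm x.1 + sqNorm x.2) *
          G ((U : Matrix TwoQubitIndex TwoQubitIndex ℂ) *ᵥ blockEquiv x) ∂unitaryHaar := by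
        rw [← lintegral_const_mul _ hind]
        refine lintegral_congr_ae ?_
        have : NullSingletonClass (volume : Measure ((Fin 2 → ℂ) × (Fin 2 → ℂ))) :=
          Measure.IsAddHaarMeasure.nullSingletonClass _
        filter_upwards [Measure.ae_ne volume (0 : (Fin 2 → ℂ) × (Fin 2 → ℂ))] with x hx
        rw [lintegral_const_mul _ (by exact hG.comp (hUm.comp measurable_prodMk_right)), hconst x hx,
          mul_comm]
    _ = ∫⁻ U : TwoQubitUnitary, ∫⁻ x : (Fin 2 → ℂ) × (Fin 2 → ℂ),
        (Set.Iio (1 : ℝ)).indicator 1 (sqNorm x.1 + sqNorm x.2) *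
          G ((U : Matrix TwoQubitIndex TwoQubitIndex ℂ) *ᵥ blockEquiv x) ∂volume ∂unitaryHaar :=
        lintegral_lintegral_swap
          ((hind.comp measurable_fst).mul (hG.comp (hUm.comp measurable_swap))).aemeasurable
    _ = ∫⁻ _ : TwoQubitUnitary, ∫⁻ x : (Fin 2 → ℂ) × (Fin 2 → ℂ),
        (Set.Iio (1 : ℝ)).indicator 1 (sqNorm x.1 + sqNorm x.2) *
          G (blockEquiv x) ∂volume ∂unitaryHaar := by
        refine lintegral_congr fun U => ?_
        refine Eq.trans ?_ ((measurePreserving_blockAction U).lintegral_comp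
          (hind.mul (hG.comp continuous_blockEquiv.measurable)))
        simp only [← totalSqNorm_blockEquiv, blockEquiv_blockAction, totalSqNorm_mulVec]
    _ = _ := by simp

lemma lintegral_ofReal_one_sub_sq : ∫⁻ z, ENNReal.ofReal (1 - z ^ 2) = ENNReal.ofReal (4 / 3) := by
  have h1 : ∫⁻ z, ENNReal.ofReal (1 - z ^ 2) =
      ∫⁻ z in Set.Ioc (-1 : ℝ) 1, ENNReal.ofReal (1 - z ^ 2) := by
    rw [← lintegral_indicator measurableSet_Ioc]
    refine lintegral_congr fun z => ?_
    by_cases hz : z ∈ Set.Ioc (-1 : ℝ) 1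
    · rw [Set.indicator_of_mem hz]
    · rw [Set.indicator_of_notMem hz, ENNReal.ofReal_of_nonpos]
      rw [Set.mem_Ioc, not_and_or, not_lt, not_le] at hz
      rcases hz with hz | hz <;> nlinarith
  rw [h1, ← ofReal_integral_eq_lintegral_ofReal, ← intervalIntegral.integral_of_le (by norm_num)]
  · rw [intervalIntegral.integral_sub (by simp) (by simp)]
    norm_num
  · exact (intervalIntegrable_iff_integrableOn_Ioc_of_le (by norm_num)).1
      ((by fun_prop : Continuous fun z : ℝ => 1 - z ^ 2).intervalIntegrable _ _)
  · refine (ae_restrict_iff' measurableSet_Ioc).2 (Filter.Eventually.of_forall fun t ht => ?_)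
    simp only [Pi.zero_apply]
    nlinarith [ht.1, ht.2]

/-- The difference of the weights of the two blocks of a Haar-random unit vector has density
`3 / 4 * (1 - z ^ 2)` on `[-1, 1]`. -/
theorem lintegral_unitaryHaar_sqNorm_sub {Φ : TwoQubitIndex → ℂ} (hΦ : totalSqNorm Φ = 1)
    {g : ℝ → ℝ≥0∞} (hg : Measurable g) :
    ∫⁻ U : TwoQubitUnitary,
        g (sqNorm (blockEquiv.symm ((U : Matrix TwoQubitIndex TwoQubitIndex ℂ) *ᵥ Φ)).1 -
          sqNorm (blockEquiv.symm ((U : Matrix TwoQubitIndex TwoQubitIndex ℂ) *ᵥ Φ)).2)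
        ∂unitaryHaar =
      ∫⁻ z, ENNReal.ofReal (3 / 4 * (1 - z ^ 2)) * g z := by
  have hG : Measurable fun ψ : TwoQubitIndex → ℂ =>
      g ((sqNorm (blockEquiv.symm ψ).1 - sqNorm (blockEquiv.symm ψ).2) /
        (sqNorm (blockEquiv.symm ψ).1 + sqNorm (blockEquiv.symm ψ).2)) := by
    have h1 := (continuous_sqNorm.comp (continuous_fst.comp continuous_blockEquiv_symm)).measurable
    have h2 := (continuous_sqNorm.comp (continuous_snd.comp continuous_blockEquiv_symm)).measurable
    exact hg.comp ((h1.sub h2).div (h1.add h2))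
  have key := lintegral_unitaryHaar_mul hΦ hG fun r ψ hr => by
    simp only [map_smul, Prod.smul_fst, Prod.smul_snd, sqNorm_smul, ← mul_sub, ← mul_add]
    rw [mul_div_mul_left _ _ (by positivity)]
  have hone := lintegral_unitaryHaar_mul hΦ (G := fun _ => 1) measurable_const fun _ _ _ => rfl
  obtain ⟨C, hC0, hC1, hC⟩ := exists_lintegral_ball_ratio
  have hCone := hC (fun _ => 1) measurable_const
  simp only [LinearEquiv.symm_apply_apply, ← totalSqNorm_eq_add, totalSqNorm_mulVec, hΦ,
    div_one] at key
  simp only [mul_one, lintegral_ofReal_one_sub_sq] at hCone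
  rw [hC g hg, hCone, mul_left_comm] at key
  have key' := (ENNReal.mul_right_inj hC0 hC1).1 key
  simp_rw [ENNReal.ofReal_mul (show (0 : ℝ) ≤ 3 / 4 by norm_num), mul_assoc]
  rw [lintegral_const_mul _ (by fun_prop), ← key', mul_left_comm,
    ← ENNReal.ofReal_mul (by norm_num)]
  norm_num

lemma exists_hermitian_unitary_conj_pauli {n : Fin 3 → ℝ} (hn : ∑ k, n k ^ 2 = 1) :
    ∃ V : Matrix (Fin 2) (Fin 2) ℂ, Vᴴ = V ∧ V * V = 1 ∧
      V * pauli 2 * V = ∑ k, ((n k : ℝ) : ℂ) • pauli k := by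
  rw [Fin.sum_univ_three] at hn
  rcases eq_or_ne (n 2) (-1) with h | h
  · have h0 : n 0 = 0 := by nlinarith [sq_nonneg (n 0), sq_nonneg (n 1)]
    have h1 : n 1 = 0 := by nlinarith [sq_nonneg (n 0), sq_nonneg (n 1)]
    refine ⟨pauli 0, ?_, ?_, ?_⟩ <;> ext i j <;> fin_cases i <;> fin_cases j <;>
      simp [pauli, Matrix.mul_apply, Fin.sum_univ_succ, h, h0, h1]
  · have hz : 0 < 1 + n 2 := by
      refine lt_of_le_of_ne (by nlinarith [sq_nonneg (n 0), sq_nonneg (n 1)]) fun h' => h ?_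
      linarith
    obtain ⟨r, hr⟩ : ∃ r : ℝ, r ^ 2 * (2 * (1 + n 2)) = 1 := by
      refine ⟨(√(2 * (1 + n 2)))⁻¹, ?_⟩
      rw [inv_pow, Real.sq_sqrt (by positivity), inv_mul_cancel₀ (by positivity)]
    have hr' : (r : ℂ) ^ 2 * (2 * (1 + n 2)) = 1 := by exact_mod_cast hr
    have hn' : (n 0 : ℂ) ^ 2 + n 1 ^ 2 + n 2 ^ 2 = 1 := by exact_mod_cast hn
    have hI := Complex.I_sq
    refine ⟨!![(r : ℂ) * (1 + n 2), r * (n 0 - Complex.I * n 1);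
      r * (n 0 + Complex.I * n 1), -(r * (1 + n 2))], ?_, ?_, ?_⟩ <;>
      ext i j <;> fin_cases i <;> fin_cases j <;>
      simp [pauli, Matrix.mul_apply, Fin.sum_univ_succ]
    · exact Or.inl (by ring)
    · linear_combination hr' + r ^ 2 * hn' - r ^ 2 * n 1 ^ 2 * hI
    · ring
    · ring
    · linear_combination hr' + r ^ 2 * hn' - r ^ 2 * n 1 ^ 2 * hI
    · linear_combination n 2 * hr' - r ^ 2 * hn' + r ^ 2 * n 1 ^ 2 * hI
    · linear_combination (n 0 - Complex.I * n 1) * hr'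
    · linear_combination (n 0 + Complex.I * n 1) * hr'
    · linear_combination -n 2 * hr' + r ^ 2 * hn' - r ^ 2 * n 1 ^ 2 * hI

lemma reducedState_apply (Φ : EuclideanSpace ℂ TwoQubitIndex) (U : TwoQubitUnitary) (i j : Fin 2) :
    reducedState Φ U i j = ∑ k, ((U : Matrix TwoQubitIndex TwoQubitIndex ℂ) *ᵥ Φ.ofLp) (i, k) *
      star (((U : Matrix TwoQubitIndex TwoQubitIndex ℂ) *ᵥ Φ.ofLp) (j, k)) := rfl

lemma continuous_reducedState (Φ : EuclideanSpace ℂ TwoQubitIndex) :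
    Continuous (reducedState Φ) := by
  have h : Continuous fun U : TwoQubitUnitary =>
      (U : Matrix TwoQubitIndex TwoQubitIndex ℂ) *ᵥ Φ.ofLp :=
    continuous_subtype_val.matrix_mulVec continuous_const
  refine continuous_matrix fun i j => ?_
  simp only [reducedState_apply]
  exact continuous_finsetSum _ fun k _ =>
    ((continuous_apply _).comp h).mul ((continuous_apply _).comp h).star

lemma trace_reducedState (Φ : EuclideanSpace ℂ TwoQubitIndex) (hΦ : ‖Φ‖ = 1)
    (U : TwoQubitUnitary) : (reducedState Φ U).trace = 1 := by
  have h : totalSqNorm ((U : Matrix TwoQubitIndex TwoQubitIndex ℂ) *ᵥ Φ.ofLp) = 1 := by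
    rw [totalSqNorm_mulVec, totalSqNorm_ofLp, hΦ, one_pow]
  have h' : ((totalSqNorm ((U : Matrix TwoQubitIndex TwoQubitIndex ℂ) *ᵥ Φ.ofLp) : ℝ) : ℂ) = 1 := by
    rw [h, Complex.ofReal_one]
  rw [ofReal_totalSqNorm] at h'
  rw [← h']
  simp only [Matrix.trace, Matrix.diag, reducedState_apply, dotProduct, Fintype.sum_prod_type,
    Pi.star_apply, mul_comm]

lemma meanValue_pauli_two_reducedState (Φ : EuclideanSpace ℂ TwoQubitIndex) (U : TwoQubitUnitary) :
    meanValue (pauli 2) (reducedState Φ U) =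
      sqNorm (blockEquiv.symm ((U : Matrix TwoQubitIndex TwoQubitIndex ℂ) *ᵥ Φ.ofLp)).1 -
        sqNorm (blockEquiv.symm ((U : Matrix TwoQubitIndex TwoQubitIndex ℂ) *ᵥ Φ.ofLp)).2 := by
  have h : meanValue (pauli 2) (reducedState Φ U) =
      (reducedState Φ U 0 0).re - (reducedState Φ U 1 1).re := by
    simp [meanValue, pauli, Matrix.trace, Matrix.vecMul, dotProduct, Fin.sum_univ_succ,
      sub_eq_add_neg]
  rw [h]
  simp [reducedState_apply, sqNorm, blockEquiv, Complex.normSq_apply]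

lemma reducedState_kronecker_mul (Φ : EuclideanSpace ℂ TwoQubitIndex) (U : TwoQubitUnitary)
    (V : Matrix (Fin 2) (Fin 2) ℂ) (hV : V ⊗ₖ (1 : Matrix (Fin 2) (Fin 2) ℂ) ∈
      unitaryGroup TwoQubitIndex ℂ) :
    reducedState Φ (⟨_, hV⟩ * U) = V * reducedState Φ U * Vᴴ := by
  have h (i k : Fin 2) : (((⟨_, hV⟩ * U : TwoQubitUnitary) :
      Matrix TwoQubitIndex TwoQubitIndex ℂ) *ᵥ Φ.ofLp) (i, k) =
      ∑ j, V i j * ((U : Matrix TwoQubitIndex TwoQubitIndex ℂ) *ᵥ Φ.ofLp) (j, k) := by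
    rw [Submonoid.coe_mul, ← mulVec_mulVec]
    simp [mulVec, dotProduct, Fintype.sum_prod_type, Matrix.one_apply, kroneckerMap_apply]
  ext i j
  simp only [reducedState_apply, h, Matrix.mul_apply, conjTranspose_apply, Fin.sum_univ_two,
    star_add, star_mul']
  ring

lemma continuous_meanValue (A : Matrix (Fin 2) (Fin 2) ℂ) : Continuous (meanValue A) :=
  Complex.continuous_re.comp (continuous_const.matrix_mul continuous_id).matrix_trace

/-- The Bloch vector of a state of a qubit. -/
noncomputable def blochVector (ρ : Matrix (Fin 2) (Fin 2) ℂ) : EuclideanSpace ℝ (Fin 3) :=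
  WithLp.toLp 2 fun k => meanValue (pauli k) ρ

lemma measurable_blochVector : Measurable blochVector :=
  ((PiLp.continuous_toLp 2 _).comp
    (continuous_pi fun k => continuous_meanValue (pauli k))).measurable

lemma meanValue_sum_smul_pauli (a : EuclideanSpace ℝ (Fin 3)) (ρ : Matrix (Fin 2) (Fin 2) ℂ) :
    meanValue (∑ k, ((a k : ℝ) : ℂ) • pauli k) ρ = inner ℝ a (blochVector ρ) := by
  simp [meanValue, Finset.sum_mul, Matrix.trace_sum, blochVector, PiLp.inner_apply, mul_comm]

lemma meanValue_qubitObservable (a₀ : ℝ) (a : EuclideanSpace ℝ (Fin 3))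
    {ρ : Matrix (Fin 2) (Fin 2) ℂ} (hρ : ρ.trace = 1) :
    meanValue (qubitObservable a₀ a) ρ = a₀ + inner ℝ a (blochVector ρ) := by
  rw [← meanValue_sum_smul_pauli]
  simp [meanValue, qubitObservable, add_mul, hρ]

/-- The law of the Bloch vector of the reduced state of a Haar-random pure state. -/
noncomputable def blochLaw (Φ : EuclideanSpace ℂ TwoQubitIndex) :
    Measure (EuclideanSpace ℝ (Fin 3)) :=
  (reducedStateLaw Φ).map blochVector

lemma blochLaw_eq_map (Φ : EuclideanSpace ℂ TwoQubitIndex) :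
    blochLaw Φ = unitaryHaar.map fun U => blochVector (reducedState Φ U) :=
  Measure.map_map measurable_blochVector (continuous_reducedState Φ).measurable

instance blochLaw_isProbabilityMeasure (Φ : EuclideanSpace ℂ TwoQubitIndex) :
    IsProbabilityMeasure (blochLaw Φ) := by
  rw [blochLaw_eq_map]
  exact Measure.isProbabilityMeasure_map
    (measurable_blochVector.comp (continuous_reducedState Φ).measurable).aemeasurable

theorem map_inner_blochLaw {Φ : EuclideanSpace ℂ TwoQubitIndex} (hΦ : ‖Φ‖ = 1)
    {n : EuclideanSpace ℝ (Fin 3)} (hn : ‖n‖ = 1) :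
    (blochLaw Φ).map (fun x => inner ℝ n x) =
      volume.withDensity fun z => ENNReal.ofReal (3 / 4 * (1 - z ^ 2)) := by
  have hmb := measurable_blochVector.comp (continuous_reducedState Φ).measurable
  have hmi : Measurable fun x : EuclideanSpace ℝ (Fin 3) => (inner ℝ n x : ℝ) := by fun_prop
  obtain ⟨V, hVH, hVV, hV⟩ := exists_hermitian_unitary_conj_pauli (n := n)
    (by simpa [hn] using (EuclideanSpace.norm_sq_eq n).symm)
  have hVu : V ∈ unitaryGroup (Fin 2) ℂ := by
    rw [mem_unitaryGroup_iff, star_eq_conjTranspose, hVH, hVV]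
  have hK : V ⊗ₖ (1 : Matrix (Fin 2) (Fin 2) ℂ) ∈ unitaryGroup TwoQubitIndex ℂ :=
    kronecker_mem_unitary hVu (one_mem _)
  refine Measure.ext_of_lintegral _ fun g hg => ?_
  rw [lintegral_map hg hmi, blochLaw_eq_map, lintegral_map (by exact hg.comp hmi) (by exact hmb),
    lintegral_withDensity_eq_lintegral_mul _ (by fun_prop) hg,
    ← lintegral_mul_left_eq_self (μ := unitaryHaar) _ ⟨_, hK⟩]
  refine Eq.trans (lintegral_congr fun U => ?_) (lintegral_unitaryHaar_sqNorm_sub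
    (Φ := Φ.ofLp) (by rw [totalSqNorm_ofLp, hΦ, one_pow]) hg)
  rw [reducedState_kronecker_mul, ← meanValue_pauli_two_reducedState, ← meanValue_sum_smul_pauli,
    ← hV, hVH]
  congr 1
  unfold meanValue
  rw [show V * pauli 2 * V * (V * reducedState Φ U * V) =
    V * (pauli 2 * (V * V) * reducedState Φ U * V) by simp only [Matrix.mul_assoc], hVV,
    Matrix.mul_one, Matrix.trace_mul_comm, Matrix.mul_assoc, hVV, Matrix.mul_one]

lemma volume_sum_sq_lt (ρ : ℝ) :
    volume {y : Fin 2 → ℝ | ∑ k, y k ^ 2 < ρ} = ENNReal.ofReal (Real.pi * ρ) := by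
  rcases le_or_gt ρ 0 with h | h
  · have : {y : Fin 2 → ℝ | ∑ k, y k ^ 2 < ρ} = ∅ :=
      Set.eq_empty_of_forall_notMem fun y hy =>
        (hy.trans_le h).not_ge (Finset.sum_nonneg fun _ _ => sq_nonneg _)
    rw [this, measure_empty, ENNReal.ofReal_of_nonpos]
    exact mul_nonpos_of_nonneg_of_nonpos Real.pi_pos.le h
  · have hm : MeasurableSet {y : Fin 2 → ℝ | ∑ k, y k ^ 2 < ρ} :=
      measurableSet_lt (by fun_prop) measurable_const
    rw [← (PiLp.volume_preserving_ofLp (Fin 2)).measure_preimage hm.nullMeasurableSet]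
    have : WithLp.ofLp ⁻¹' {y : Fin 2 → ℝ | ∑ k, y k ^ 2 < ρ} =
        Metric.ball (0 : EuclideanSpace ℝ (Fin 2)) √ρ := by
      ext y
      rw [mem_ball_zero_iff, Real.lt_sqrt (norm_nonneg _), EuclideanSpace.real_norm_sq_eq]
      rfl
    rw [this, EuclideanSpace.volume_ball_fin_two, ← ENNReal.ofReal_pow (Real.sqrt_nonneg _),
      Real.sq_sqrt h.le, mul_comm, ENNReal.ofReal_mul Real.pi_pos.le]

lemma lintegral_ball_apply_zero {g : ℝ → ℝ≥0∞} (hg : Measurable g) :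
    ∫⁻ x in Metric.ball (0 : EuclideanSpace ℝ (Fin 3)) 1, g (x 0) =
      ∫⁻ z, ENNReal.ofReal (Real.pi * (1 - z ^ 2)) * g z := by
  set S : Set (ℝ × (Fin 2 → ℝ)) := {z | ∑ k, z.2 k ^ 2 < 1 - z.1 ^ 2} with hS
  have hSm : MeasurableSet S := measurableSet_lt (by fun_prop) (by fun_prop)
  have hF : Measurable (S.indicator fun z => g z.1) :=
    (hg.comp measurable_fst).indicator hSm
  have e1 := volume_preserving_piFinSuccAbove (fun _ : Fin 3 => ℝ) 0
  have e2 := e1.comp (PiLp.volume_preserving_ofLp (Fin 3))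
  rw [← lintegral_indicator measurableSet_ball]
  calc _ = ∫⁻ x : EuclideanSpace ℝ (Fin 3), (S.indicator fun z => g z.1)
        ((MeasurableEquiv.piFinSuccAbove (fun _ : Fin 3 => ℝ) 0) (WithLp.ofLp x)) := by
        refine lintegral_congr fun x => ?_
        have : x ∈ Metric.ball (0 : EuclideanSpace ℝ (Fin 3)) 1 ↔
            (MeasurableEquiv.piFinSuccAbove (fun _ : Fin 3 => ℝ) 0) (WithLp.ofLp x) ∈ S := by
          rw [mem_ball_zero_iff, ← sq_lt_one_iff₀ (norm_nonneg _), EuclideanSpace.real_norm_sq_eq,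
            Fin.sum_univ_succ]
          simp [hS, Fin.tail, lt_sub_iff_add_lt']
        by_cases hx : x ∈ Metric.ball (0 : EuclideanSpace ℝ (Fin 3)) 1
        · rw [Set.indicator_of_mem hx, Set.indicator_of_mem (this.1 hx)]
          rfl
        · rw [Set.indicator_of_notMem hx, Set.indicator_of_notMem (mt this.2 hx)]
    _ = ∫⁻ z : ℝ × (Fin 2 → ℝ), S.indicator (fun z => g z.1) z := e2.lintegral_comp hF
    _ = ∫⁻ z, ∫⁻ y, S.indicator (fun z => g z.1) (z, y) := by
        rw [Measure.volume_eq_prod, lintegral_prod _ hF.aemeasurable]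
    _ = _ := by
        refine lintegral_congr fun z => ?_
        have : (fun y => S.indicator (fun z => g z.1) (z, y)) =
            {y : Fin 2 → ℝ | ∑ k, y k ^ 2 < 1 - z ^ 2}.indicator fun _ => g z := rfl
        rw [this, lintegral_indicator_const (measurableSet_lt (by fun_prop) measurable_const),
          volume_sum_sq_lt, mul_comm]

lemma lintegral_ball_inner {n : EuclideanSpace ℝ (Fin 3)} (hn : ‖n‖ = 1) {g : ℝ → ℝ≥0∞}
    (hg : Measurable g) :
    ∫⁻ x in Metric.ball (0 : EuclideanSpace ℝ (Fin 3)) 1, g (inner ℝ n x) =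
      ∫⁻ z, ENNReal.ofReal (Real.pi * (1 - z ^ 2)) * g z := by
  obtain ⟨b, hb⟩ := Orthonormal.exists_orthonormalBasis_extension_of_card_eq
    (𝕜 := ℝ) (E := EuclideanSpace ℝ (Fin 3)) (ι := Fin 3) (by simp)
    (v := fun _ => n) (s := {0})
    ⟨fun _ => hn, fun i j hij => absurd (Subsingleton.elim i j) hij⟩
  have hpre : b.repr ⁻¹' Metric.ball (0 : EuclideanSpace ℝ (Fin 3)) 1 = Metric.ball 0 1 := by
    ext x
    simp
  have h := b.repr.measurePreserving.restrict_preimage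
    (measurableSet_ball (x := (0 : EuclideanSpace ℝ (Fin 3))) (ε := 1))
  rw [hpre] at h
  rw [← lintegral_ball_apply_zero hg, ← h.lintegral_comp (f := fun x => g (x 0)) (by fun_prop)]
  simp only [b.repr_apply_apply, hb 0 rfl]

/-- The uniform distribution on the unit ball of `ℝ³`. -/
noncomputable def uniformBall : Measure (EuclideanSpace ℝ (Fin 3)) :=
  ENNReal.ofReal (3 / (4 * Real.pi)) • volume.restrict (Metric.ball 0 1)

instance uniformBall_isFiniteMeasure : IsFiniteMeasure uniformBall := by
  have : IsFiniteMeasure ((volume : Measure (EuclideanSpace ℝ (Fin 3))).restrict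
    (Metric.ball 0 1)) := ⟨by simp⟩
  exact Measure.smul_finite _ ENNReal.ofReal_ne_top

lemma map_inner_uniformBall {n : EuclideanSpace ℝ (Fin 3)} (hn : ‖n‖ = 1) :
    uniformBall.map (fun x => inner ℝ n x) =
      volume.withDensity fun z => ENNReal.ofReal (3 / 4 * (1 - z ^ 2)) := by
  refine Measure.ext_of_lintegral _ fun g hg => ?_
  rw [lintegral_map hg (by fun_prop), uniformBall, lintegral_smul_measure,
    lintegral_ball_inner hn hg, lintegral_withDensity_eq_lintegral_mul _ (by fun_prop) hg,
    smul_eq_mul, ← lintegral_const_mul _ (by fun_prop)]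
  refine lintegral_congr fun z => ?_
  rw [← mul_assoc, ← ENNReal.ofReal_mul (by positivity), Pi.mul_apply]
  congr 2
  field_simp

/-- Finite measures on a Euclidean space agree when their images under all functionals
`⟪n, ·⟫` with `n` a unit vector agree. -/
lemma ext_of_map_inner {E : Type*} [NormedAddCommGroup E] [InnerProductSpace ℝ E]
    [FiniteDimensional ℝ E] [Nontrivial E] [MeasurableSpace E] [BorelSpace E] {μ ν : Measure E}
    [IsFiniteMeasure μ] [IsFiniteMeasure ν]
    (h : ∀ n : E, ‖n‖ = 1 → μ.map (fun x => inner ℝ n x) = ν.map (fun x => inner ℝ n x)) :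
    μ = ν := by
  have := FiniteDimensional.proper_real E
  refine Measure.ext_of_charFun (funext fun t => ?_)
  obtain ⟨n, r, hn, rfl⟩ : ∃ (n : E) (r : ℝ), ‖n‖ = 1 ∧ t = r • n := by
    rcases eq_or_ne t 0 with rfl | ht
    · obtain ⟨n, hn⟩ := exists_norm_eq E zero_le_one
      exact ⟨n, 0, hn, by simp⟩
    · exact ⟨‖t‖⁻¹ • t, ‖t‖, norm_smul_inv_norm ht, by
        rw [smul_smul, mul_inv_cancel₀ (norm_ne_zero_iff.2 ht), one_smul]⟩
  have key (κ : Measure E) : charFun κ (r • n) =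
      ∫ z, Complex.exp (r * z * Complex.I) ∂(κ.map fun x => inner ℝ n x) := by
    rw [charFun_apply, integral_map (by fun_prop) (by fun_prop)]
    simp [inner_smul_right, real_inner_comm]
  rw [key, key, h n hn]

theorem blochLaw_eq_uniformBall {Φ : EuclideanSpace ℂ TwoQubitIndex} (hΦ : ‖Φ‖ = 1) :
    blochLaw Φ = uniformBall :=
  ext_of_map_inner fun n hn => by rw [map_inner_blochLaw hΦ hn, map_inner_uniformBall hn]

lemma reducedStateLaw_map_meanValue {Φ : EuclideanSpace ℂ TwoQubitIndex} (hΦ : ‖Φ‖ = 1)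
    (a₀ : ℝ) (a : EuclideanSpace ℝ (Fin 3)) :
    (reducedStateLaw Φ).map (meanValue (qubitObservable a₀ a)) =
      uniformBall.map fun x => a₀ + inner ℝ a x := by
  have hρ := (continuous_reducedState Φ).measurable
  rw [← blochLaw_eq_uniformBall hΦ, blochLaw_eq_map,
    Measure.map_map (by fun_prop) (by exact measurable_blochVector.comp hρ), reducedStateLaw,
    Measure.map_map (continuous_meanValue _).measurable hρ]
  congr 1
  ext U
  exact meanValue_qubitObservable a₀ a (trace_reducedState Φ hΦ U)

lemma meanValueLaw_eq_map_uniformBall {Φ : EuclideanSpace ℂ TwoQubitIndex} (hΦ : ‖Φ‖ = 1) {n : ℕ}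
    (a₀ : Fin n → ℝ) (a : Fin n → EuclideanSpace ℝ (Fin 3)) :
    meanValueLaw Φ (fun i => qubitObservable (a₀ i) (a i)) =
      uniformBall.map fun x i => a₀ i + inner ℝ (a i) x := by
  have hρ := (continuous_reducedState Φ).measurable
  have hm : Measurable fun (ρ : Matrix (Fin 2) (Fin 2) ℂ) i =>
      meanValue (qubitObservable (a₀ i) (a i)) ρ :=
    measurable_pi_lambda _ fun i => (continuous_meanValue _).measurable
  rw [← blochLaw_eq_uniformBall hΦ, blochLaw_eq_map,
    Measure.map_map (by fun_prop) (by exact measurable_blochVector.comp hρ), meanValueLaw,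
    reducedStateLaw, Measure.map_map hm hρ]
  congr 1
  ext U i
  exact meanValue_qubitObservable (a₀ i) (a i) (trace_reducedState Φ hΦ U)

/-! ### One observable -/

lemma ofReal_meanDensityOne_mul (a₀ : ℝ) {a : EuclideanSpace ℝ (Fin 3)} (ha : a ≠ 0) (z : ℝ) :
    ENNReal.ofReal ‖a‖ * ENNReal.ofReal (meanDensityOne a₀ a (a₀ + ‖a‖ * z)) =
      ENNReal.ofReal (3 / 4 * (1 - z ^ 2)) := by
  have hR : 0 < ‖a‖ := norm_pos_iff.2 ha
  rw [← ENNReal.ofReal_mul hR.le]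
  have h1 : a₀ + ‖a‖ * z - (a₀ - ‖a‖) = ‖a‖ * (1 + z) := by ring
  have h2 : a₀ + ‖a‖ - (a₀ + ‖a‖ * z) = ‖a‖ * (1 - z) := by ring
  have h3 : a₀ + ‖a‖ * z - (a₀ + ‖a‖) = ‖a‖ * (z - 1) := by ring
  have h4 : a₀ + ‖a‖ - (a₀ - ‖a‖) = 2 * ‖a‖ := by ring
  have e1 : (0 ≤ ‖a‖ * (1 + z)) ↔ 0 ≤ 1 + z := mul_nonneg_iff_of_pos_left hR
  have e2 : (0 ≤ ‖a‖ * (z - 1)) ↔ 0 ≤ z - 1 := mul_nonneg_iff_of_pos_left hR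
  have key : ‖a‖ * meanDensityOne a₀ a (a₀ + ‖a‖ * z) = 3 / 4 * (1 - z ^ 2) *
      (heaviside (1 + z) - heaviside (z - 1)) := by
    simp only [meanDensityOne, h1, h2, h3, h4]
    simp only [heaviside, e1, e2]
    field_simp
    ring
  rw [key]
  simp only [heaviside]
  split_ifs with ha hb hb
  · rw [sub_self, mul_zero, ENNReal.ofReal_zero, ENNReal.ofReal_of_nonpos (by nlinarith)]
  · simp
  · linarith
  · rw [sub_self, mul_zero, ENNReal.ofReal_zero, ENNReal.ofReal_of_nonpos (by nlinarith)]

lemma measurable_meanDensityOne (a₀ : ℝ) (a : EuclideanSpace ℝ (Fin 3)) :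
    Measurable (meanDensityOne a₀ a) := by
  have hh : Measurable heaviside :=
    Measurable.ite measurableSet_Ici measurable_const measurable_const
  unfold meanDensityOne
  fun_prop

theorem map_uniformBall_one (a₀ : ℝ) {a : EuclideanSpace ℝ (Fin 3)} (ha : a ≠ 0) :
    uniformBall.map (fun x => a₀ + inner ℝ a x) =
      volume.withDensity fun r => ENNReal.ofReal (meanDensityOne a₀ a r) := by
  have hR : 0 < ‖a‖ := norm_pos_iff.2 ha
  have hmD := measurable_meanDensityOne a₀ a
  have hvol : (volume : Measure ℝ).map (fun z => a₀ + ‖a‖ * z) =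
      ENNReal.ofReal |‖a‖⁻¹| • volume := by
    rw [show (fun z : ℝ => a₀ + ‖a‖ * z) = (fun z => a₀ + z) ∘ fun z => ‖a‖ * z from rfl,
      ← Measure.map_map (by fun_prop) (by fun_prop), Real.map_volume_mul_left hR.ne',
      Measure.map_smul, (measurePreserving_add_left (volume : Measure ℝ) a₀).map_eq]
  have hcomp : (fun x : EuclideanSpace ℝ (Fin 3) => a₀ + inner ℝ a x) =
      (fun z => a₀ + ‖a‖ * z) ∘ fun x => inner ℝ (‖a‖⁻¹ • a) x := by
    ext x
    simp only [Function.comp_apply, real_inner_smul_left]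
    field_simp
  rw [hcomp, ← Measure.map_map (by fun_prop) (by fun_prop),
    map_inner_uniformBall (n := ‖a‖⁻¹ • a) (norm_smul_inv_norm ha)]
  refine Measure.ext_of_lintegral _ fun g hg => ?_
  have hDg : Measurable fun r => ENNReal.ofReal (meanDensityOne a₀ a r) * g r := by fun_prop
  have hsub := lintegral_map hDg (by fun_prop : Measurable fun z => a₀ + ‖a‖ * z) (μ := volume)
  rw [hvol, lintegral_smul_measure, smul_eq_mul] at hsub
  rw [lintegral_map hg (by fun_prop), lintegral_withDensity_eq_lintegral_mul _ (by fun_prop)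
    (by fun_prop), lintegral_withDensity_eq_lintegral_mul _ (by fun_prop) hg]
  have hone : ENNReal.ofReal ‖a‖ * ENNReal.ofReal |‖a‖⁻¹| = 1 := by
    rw [← ENNReal.ofReal_mul hR.le, abs_of_pos (by positivity), mul_inv_cancel₀ hR.ne',
      ENNReal.ofReal_one]
  calc _ = ENNReal.ofReal ‖a‖ * ∫⁻ z, ENNReal.ofReal (meanDensityOne a₀ a (a₀ + ‖a‖ * z)) *
        g (a₀ + ‖a‖ * z) := by
        rw [← lintegral_const_mul _ (by fun_prop)]
        refine lintegral_congr fun z => ?_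
        rw [Pi.mul_apply, ← ofReal_meanDensityOne_mul a₀ ha, mul_assoc]
    _ = _ := by
        rw [← hsub, ← mul_assoc, hone, one_mul]
        rfl

/-! ### Three observables -/

lemma omega_add_inner {n : ℕ} (a₀ : Fin n → ℝ) {a : Fin n → EuclideanSpace ℝ (Fin 3)}
    (ha : LinearIndependent ℝ a) (c : Fin n → ℝ) :
    omega a₀ a (fun i => a₀ i + inner ℝ (a i) (∑ j, c j • a j)) = ‖∑ j, c j • a j‖ := by
  have hdet : IsUnit (gram ℝ a).det :=
    isUnit_iff_ne_zero.2 (det_gram_ne_zero_iff_linearIndependent.2 ha)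
  have h1 : (fun i => a₀ i + inner ℝ (a i) (∑ j, c j • a j)) - a₀ = gram ℝ a *ᵥ c := by
    ext i
    simp [mulVec, dotProduct, inner_sum, real_inner_smul_right, mul_comm]
  rw [omega, h1, mulVec_mulVec, nonsing_inv_mul _ hdet, one_mulVec, dotProduct_comm]
  have h2 := star_dotProduct_gram_mulVec (𝕜 := ℝ) a c c
  rw [star_trivial] at h2
  rw [h2, real_inner_self_eq_norm_sq, Real.sqrt_sq (norm_nonneg _)]

lemma continuous_omega {n : ℕ} (a₀ : Fin n → ℝ) (a : Fin n → EuclideanSpace ℝ (Fin 3)) :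
    Continuous (omega a₀ a) :=
  Real.continuous_sqrt.comp ((continuous_id.sub continuous_const).dotProduct
    (continuous_const.matrix_mulVec (continuous_id.sub continuous_const)))

lemma omega_three_add_inner (a₀ : Fin 3 → ℝ) {a : Fin 3 → EuclideanSpace ℝ (Fin 3)}
    (ha : LinearIndependent ℝ a) (x : EuclideanSpace ℝ (Fin 3)) :
    omega a₀ a (fun i => a₀ i + inner ℝ (a i) x) = ‖x‖ := by
  have hx : x ∈ Submodule.span ℝ (Set.range a) := by
    rw [ha.span_eq_top_of_card_eq_finrank (by simp)]
    trivial
  obtain ⟨c, rfl⟩ := (Submodule.mem_span_range_iff_exists_fun ℝ).1 hx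
  exact omega_add_inner a₀ ha c

lemma gram_eq_mul_transpose {n : ℕ} (a : Fin n → EuclideanSpace ℝ (Fin 3)) :
    gram ℝ a = (of fun i j => a i j) * (of fun i j => a i j)ᵀ := by
  ext i j
  simp [Matrix.mul_apply, PiLp.inner_apply, mul_comm]

lemma map_volume_add_inner (a₀ : Fin 3 → ℝ) {a : Fin 3 → EuclideanSpace ℝ (Fin 3)}
    (ha : LinearIndependent ℝ a) :
    (volume : Measure (EuclideanSpace ℝ (Fin 3))).map (fun x i => a₀ i + inner ℝ (a i) x) =
      ENNReal.ofReal (√(gram ℝ a).det)⁻¹ • volume := by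
  have hdet := det_gram_ne_zero_iff_linearIndependent.2 ha
  have hM : (gram ℝ a).det = (of fun i j => a i j : Matrix (Fin 3) (Fin 3) ℝ).det ^ 2 := by
    rw [gram_eq_mul_transpose, det_mul, det_transpose, sq]
  have hM0 : (of fun i j => a i j : Matrix (Fin 3) (Fin 3) ℝ).det ≠ 0 := by
    rintro h
    simp [hM, h] at hdet
  have hcomp : (fun (x : EuclideanSpace ℝ (Fin 3)) i => a₀ i + inner ℝ (a i) x) =
      (fun y => a₀ + y) ∘ toLin' (of fun i j => a i j : Matrix (Fin 3) (Fin 3) ℝ) ∘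
        WithLp.ofLp := by
    ext x i
    simp [mulVec, dotProduct, PiLp.inner_apply, mul_comm]
  have hlin : Measurable (toLin' (of fun i j => a i j : Matrix (Fin 3) (Fin 3) ℝ)) :=
    (LinearMap.continuous_of_finiteDimensional _).measurable
  rw [hcomp, ← Measure.map_map (by fun_prop) (hlin.comp (by fun_prop)),
    ← Measure.map_map hlin (by fun_prop), (PiLp.volume_preserving_ofLp (Fin 3)).map_eq,
    Real.map_matrix_volume_pi_eq_smul_volume_pi hM0, Measure.map_smul,
    (measurePreserving_add_left (volume : Measure (Fin 3 → ℝ)) a₀).map_eq, hM, Real.sqrt_sq_eq_abs,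
    abs_inv]

theorem map_uniformBall_three_eq_restrict (a₀ : Fin 3 → ℝ)
    {a : Fin 3 → EuclideanSpace ℝ (Fin 3)} (ha : LinearIndependent ℝ a) :
    uniformBall.map (fun x i => a₀ i + inner ℝ (a i) x) =
      ENNReal.ofReal (3 / (4 * Real.pi * √(gram ℝ a).det)) •
        volume.restrict {x | omega a₀ a x < 1} := by
  have hS : MeasurableSet {x | omega a₀ a x < 1} :=
    measurableSet_lt (continuous_omega a₀ a).measurable measurable_const
  have hF : Measurable fun (x : EuclideanSpace ℝ (Fin 3)) i => a₀ i + inner ℝ (a i) x := by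
    fun_prop
  have hpre : (fun (x : EuclideanSpace ℝ (Fin 3)) i => a₀ i + inner ℝ (a i) x) ⁻¹'
      {x | omega a₀ a x < 1} = Metric.ball 0 1 := by
    ext x
    simp [omega_three_add_inner a₀ ha]
  rw [uniformBall, Measure.map_smul, ← hpre, ← Measure.restrict_map hF hS,
    map_volume_add_inner a₀ ha, Measure.restrict_smul, smul_smul,
    ← ENNReal.ofReal_mul (by positivity)]
  congr 2
  rw [← div_eq_mul_inv, div_div]

theorem map_uniformBall_three (a₀ : Fin 3 → ℝ) {a : Fin 3 → EuclideanSpace ℝ (Fin 3)}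
    (ha : LinearIndependent ℝ a) :
    uniformBall.map (fun x i => a₀ i + inner ℝ (a i) x) =
      volume.withDensity fun x => ENNReal.ofReal (meanDensityThree a₀ a x) := by
  have hS : MeasurableSet {x | omega a₀ a x < 1} :=
    measurableSet_lt (continuous_omega a₀ a).measurable measurable_const
  have hpos : 0 < (gram ℝ a).det := (posDef_gram_of_linearIndependent ha).det_pos
  have hnull : volume {x | omega a₀ a x = 1} = 0 := by
    have hE : MeasurableSet {x | omega a₀ a x = 1} :=
      measurableSet_eq_fun (continuous_omega a₀ a).measurable measurable_const
    have h := congrArg (fun μ => μ {x | omega a₀ a x = 1}) (map_volume_add_inner a₀ ha)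
    simp only [Measure.smul_apply, smul_eq_mul] at h
    rw [Measure.map_apply (by fun_prop) hE, show (fun (x : EuclideanSpace ℝ (Fin 3)) i =>
      a₀ i + inner ℝ (a i) x) ⁻¹' {x | omega a₀ a x = 1} = Metric.sphere 0 1 by
        ext x; simp [omega_three_add_inner a₀ ha], Measure.addHaar_sphere] at h
    refine (mul_eq_zero.1 h.symm).resolve_left ?_
    simpa using hpos
  rw [map_uniformBall_three_eq_restrict a₀ ha, ← withDensity_const, ← withDensity_indicator hS]
  refine withDensity_congr_ae ?_
  filter_upwards [compl_mem_ae_iff.2 hnull] with x hx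
  rcases lt_or_gt_of_ne (show omega a₀ a x ≠ 1 from hx) with h | h
  · rw [Set.indicator_of_mem (show x ∈ {x | omega a₀ a x < 1} from h), meanDensityThree,
      Real.sign_of_pos (by linarith)]
    congr 1
    field_simp
    norm_num
  · rw [Set.indicator_of_notMem (show x ∉ {x | omega a₀ a x < 1} from h.le.not_gt),
      meanDensityThree, Real.sign_of_neg (by linarith)]
    simp

/-! ### Two observables -/

lemma volume_sq_lt (ρ : ℝ) : volume {t : ℝ | t ^ 2 < ρ} = ENNReal.ofReal (2 * √ρ) := by
  have : {t : ℝ | t ^ 2 < ρ} = Set.Ioo (-√ρ) √ρ := by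
    ext t
    exact Real.sq_lt
  rw [this, Real.volume_Ioo, sub_neg_eq_add, two_mul]

lemma exists_unit_orthogonal_pair (a b : EuclideanSpace ℝ (Fin 3)) :
    ∃ n : EuclideanSpace ℝ (Fin 3), ‖n‖ = 1 ∧ inner ℝ a n = 0 ∧ inner ℝ b n = 0 := by
  have hlt : Module.finrank ℝ (Submodule.span ℝ {a, b}) ≤ 2 := by
    classical
    exact (finrank_span_le_card _).trans (by simpa using Finset.card_le_two)
  have hadd := Submodule.finrank_add_finrank_orthogonal (Submodule.span ℝ {a, b})
  rw [finrank_euclideanSpace_fin] at hadd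
  have hne : (Submodule.span ℝ {a, b})ᗮ ≠ ⊥ := by
    intro h
    rw [h, finrank_bot] at hadd
    omega
  obtain ⟨m, hm, hm0⟩ := Submodule.exists_mem_ne_zero_of_ne_bot hne
  rw [Submodule.mem_orthogonal] at hm
  refine ⟨‖m‖⁻¹ • m, norm_smul_inv_norm hm0, ?_, ?_⟩
  · rw [real_inner_smul_right, hm a (Submodule.subset_span (by simp)), mul_zero]
  · rw [real_inner_smul_right, hm b (Submodule.subset_span (by simp)), mul_zero]

lemma ofReal_meanDensityTwo (a₀ : Fin 2 → ℝ) (a : Fin 2 → EuclideanSpace ℝ (Fin 3))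
    (x : Fin 2 → ℝ) :
    ENNReal.ofReal (meanDensityTwo a₀ a x) =
      ENNReal.ofReal (3 / (4 * Real.pi * √(gram ℝ a).det)) *
        ENNReal.ofReal (2 * √(1 - omega a₀ a x ^ 2)) := by
  rw [← ENNReal.ofReal_mul (by positivity), meanDensityTwo, heaviside]
  congr 1
  split_ifs with h
  · ring
  · rw [not_le] at h
    rw [Real.sqrt_eq_zero_of_nonpos (show 1 - omega a₀ a x ^ 2 ≤ 0 by nlinarith)]
    simp

theorem map_uniformBall_two (a₀ : Fin 2 → ℝ) {a : Fin 2 → EuclideanSpace ℝ (Fin 3)}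
    (ha : LinearIndependent ℝ a) :
    uniformBall.map (fun x i => a₀ i + inner ℝ (a i) x) =
      volume.withDensity fun x => ENNReal.ofReal (meanDensityTwo a₀ a x) := by
  obtain ⟨n, hn, hn0, hn1⟩ := exists_unit_orthogonal_pair (a 0) (a 1)
  have hnn : inner ℝ n n = (1 : ℝ) := by rw [real_inner_self_eq_norm_sq, hn, one_pow]
  set b : Fin 3 → EuclideanSpace ℝ (Fin 3) := ![a 0, a 1, n] with hb
  set b₀ : Fin 3 → ℝ := ![a₀ 0, a₀ 1, 0] with hb₀
  have hdet : (gram ℝ b).det = (gram ℝ a).det := by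
    rw [det_fin_three, det_fin_two]
    simp [hb, hn0, hn1, hn, real_inner_comm]
  have hbli : LinearIndependent ℝ b := by
    apply linearIndependent_of_det_gram_ne_zero (𝕜 := ℝ)
    rw [hdet]
    exact det_gram_ne_zero_iff_linearIndependent.2 ha
  have hω (y : Fin 2 → ℝ) (t : ℝ) :
      omega b₀ b ![y 0, y 1, t] < 1 ↔ t ^ 2 < 1 - omega a₀ a y ^ 2 := by
    have hu : IsUnit (gram ℝ a).det :=
      isUnit_iff_ne_zero.2 (det_gram_ne_zero_iff_linearIndependent.2 ha)
    obtain ⟨c, hc⟩ : ∃ c, gram ℝ a *ᵥ c = y - a₀ :=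
      ⟨(gram ℝ a)⁻¹ *ᵥ (y - a₀), by rw [mulVec_mulVec, mul_nonsing_inv _ hu, one_mulVec]⟩
    have hy (i : Fin 2) : y i = a₀ i + inner ℝ (a i) (∑ j, c j • a j) := by
      have := congrFun hc i
      simp only [mulVec, dotProduct, gram_apply, Pi.sub_apply] at this
      simp only [inner_sum, real_inner_smul_right, mul_comm (c _), this]
      ring
    have h1 := omega_add_inner a₀ ha c
    rw [← show y = _ from funext hy] at h1
    have h2 := omega_three_add_inner b₀ hbli ((∑ j, c j • a j) + t • n)
    have h3 : (fun i => b₀ i + inner ℝ (b i) ((∑ j, c j • a j) + t • n)) = ![y 0, y 1, t] := by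
      have hn0' : inner ℝ n (a 0) = (0 : ℝ) := by rw [real_inner_comm, hn0]
      have hn1' : inner ℝ n (a 1) = (0 : ℝ) := by rw [real_inner_comm, hn1]
      ext i
      fin_cases i
      · simp [hb, hb₀, inner_add_right, real_inner_smul_right, hn0, hy]
      · simp [hb, hb₀, inner_add_right, real_inner_smul_right, hn1, hy]
      · simp [hb, hb₀, inner_add_right, real_inner_smul_right, hn0', hn1', hn]
    have h4 : ‖(∑ j, c j • a j) + t • n‖ ^ 2 = ‖∑ j, c j • a j‖ ^ 2 + t ^ 2 := by
      rw [norm_add_sq_real, real_inner_smul_right, Fin.sum_univ_two, inner_add_left,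
        real_inner_smul_left, real_inner_smul_left, hn0, hn1, norm_smul, hn]
      simp
    rw [h3] at h2
    rw [h1, h2, ← sq_lt_one_iff₀ (norm_nonneg _), h4, lt_sub_iff_add_lt']
  have hS : MeasurableSet {x | omega b₀ b x < 1} :=
    measurableSet_lt (continuous_omega b₀ b).measurable measurable_const
  have hcomp : (fun (x : EuclideanSpace ℝ (Fin 3)) i => a₀ i + inner ℝ (a i) x) =
      (fun y : Fin 3 → ℝ => ![y 0, y 1]) ∘ fun x i => b₀ i + inner ℝ (b i) x := by
    ext x i
    fin_cases i <;> simp [hb, hb₀]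
  have hproj : Measurable fun y : Fin 3 → ℝ => ![y 0, y 1] := by
    refine measurable_pi_lambda _ fun i => ?_
    fin_cases i <;> simp <;> fun_prop
  have hω2 := (continuous_omega a₀ a).measurable
  rw [hcomp, ← Measure.map_map hproj (by fun_prop), map_uniformBall_three_eq_restrict b₀ hbli, hdet]
  refine Measure.ext_of_lintegral _ fun g hg => ?_
  set S : Set (ℝ × (Fin 2 → ℝ)) := {z | z.1 ^ 2 < 1 - omega a₀ a z.2 ^ 2} with hSdef
  have hSm : MeasurableSet S := measurableSet_lt (by fun_prop) (by fun_prop)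
  have hG : Measurable (S.indicator fun z => g z.2) := (hg.comp measurable_snd).indicator hSm
  have hmD : Measurable fun x => ENNReal.ofReal (meanDensityTwo a₀ a x) := by
    simp only [ofReal_meanDensityTwo]
    fun_prop
  rw [lintegral_map hg hproj, lintegral_smul_measure, ← lintegral_indicator hS,
    lintegral_withDensity_eq_lintegral_mul _ hmD hg]
  have e1 := volume_preserving_piFinSuccAbove (fun _ : Fin 3 => ℝ) (Fin.last 2)
  calc _ = ENNReal.ofReal (3 / (4 * Real.pi * √(gram ℝ a).det)) • ∫⁻ y : Fin 3 → ℝ,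
        (S.indicator fun z => g z.2)
          (MeasurableEquiv.piFinSuccAbove (fun _ : Fin 3 => ℝ) (Fin.last 2) y) := by
        congr 1
        refine lintegral_congr fun y => ?_
        have hy : (MeasurableEquiv.piFinSuccAbove (fun _ : Fin 3 => ℝ) (Fin.last 2) y) =
            (y 2, ![y 0, y 1]) := by
          refine Prod.ext rfl ?_
          ext i
          fin_cases i <;> rfl
        have hy' : ![y 0, y 1, y 2] = y := by
          ext i
          fin_cases i <;> rfl
        have hiff := hω ![y 0, y 1] (y 2)
        simp only [cons_val_zero, cons_val_one, hy'] at hiff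
        rw [hy]
        by_cases h : omega b₀ b y < 1
        · rw [Set.indicator_of_mem (show y ∈ {x | omega b₀ b x < 1} from h),
            Set.indicator_of_mem (show (y 2, ![y 0, y 1]) ∈ S from hiff.1 h)]
        · rw [Set.indicator_of_notMem (show y ∉ {x | omega b₀ b x < 1} from h),
            Set.indicator_of_notMem (show (y 2, ![y 0, y 1]) ∉ S from mt hiff.2 h)]
    _ = ENNReal.ofReal (3 / (4 * Real.pi * √(gram ℝ a).det)) •
        ∫⁻ z : ℝ × (Fin 2 → ℝ), S.indicator (fun z => g z.2) z := by
        congr 1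
        exact e1.lintegral_comp hG
    _ = ENNReal.ofReal (3 / (4 * Real.pi * √(gram ℝ a).det)) •
        ∫⁻ y, ∫⁻ t, S.indicator (fun z => g z.2) (t, y) := by
        rw [Measure.volume_eq_prod, lintegral_prod_symm _ hG.aemeasurable]
    _ = _ := by
        have hin (y : Fin 2 → ℝ) : ∫⁻ t, S.indicator (fun z => g z.2) (t, y) =
            ENNReal.ofReal (2 * √(1 - omega a₀ a y ^ 2)) * g y := by
          have : (fun t => S.indicator (fun z => g z.2) (t, y)) =
            {t : ℝ | t ^ 2 < 1 - omega a₀ a y ^ 2}.indicator fun _ => g y := rfl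
          rw [this, lintegral_indicator_const (measurableSet_lt (by fun_prop) measurable_const),
            volume_sq_lt, mul_comm]
        simp_rw [hin]
        rw [smul_eq_mul, ← lintegral_const_mul _ (by fun_prop)]
        refine lintegral_congr fun y => ?_
        rw [Pi.mul_apply, ofReal_meanDensityTwo, ← mul_assoc]

/-! ### Rank of the Gram matrix -/

lemma rank_gram_eq_finrank_span {n : ℕ} (a : Fin n → EuclideanSpace ℝ (Fin 3)) :
    (gram ℝ a).rank = Module.finrank ℝ (Submodule.span ℝ (Set.range a)) := by
  rw [gram_eq_mul_transpose, rank_self_mul_transpose, rank_eq_finrank_span_row,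
    ← LinearEquiv.finrank_map_eq (WithLp.linearEquiv 2 ℝ (Fin 3 → ℝ)) (Submodule.span ℝ _),
    Submodule.map_span, ← Set.range_comp]
  rfl

lemma rank_gram_eq_iff_linearIndependent {n : ℕ} (a : Fin n → EuclideanSpace ℝ (Fin 3)) :
    (gram ℝ a).rank = n ↔ LinearIndependent ℝ a := by
  rw [rank_gram_eq_finrank_span, linearIndependent_iff_card_eq_finrank_span, Fintype.card_fin,
    eq_comm]
  rfl

lemma exists_perm_of_rank_gram_eq_two {a : Fin 3 → EuclideanSpace ℝ (Fin 3)}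
    (h : (gram ℝ a).rank = 2) :
    ∃ (σ : Equiv.Perm (Fin 3)) (κ₁ κ₂ : ℝ), LinearIndependent ℝ ![a (σ 0), a (σ 1)] ∧
      a (σ 2) = κ₁ • a (σ 0) + κ₂ • a (σ 1) := by
  rw [rank_gram_eq_finrank_span] at h
  obtain ⟨ι, f, hf, hspan, hli⟩ := exists_linearIndependent' ℝ a
  have : Finite ι := Finite.of_injective f hf
  have := Fintype.ofFinite ι
  have hcard : Fintype.card ι = 2 := by rw [← finrank_span_eq_card hli, hspan, h]
  let e := (Fintype.equivFinOfCardEq hcard).symm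
  have hne : f (e 0) ≠ f (e 1) := fun h => absurd (e.injective (hf h)) (by decide)
  obtain ⟨σ, h0, h1⟩ : ∃ σ : Equiv.Perm (Fin 3), σ 0 = f (e 0) ∧ σ 1 = f (e 1) := by
    generalize f (e 0) = i at hne
    generalize f (e 1) = j at hne
    revert i j
    decide
  have hpair : ![a (σ 0), a (σ 1)] = (a ∘ f) ∘ e := by
    ext1 i
    fin_cases i <;> simp [h0, h1]
  have hmem : a (σ 2) ∈ Submodule.span ℝ {a (σ 0), a (σ 1)} := by
    have hr : ({a (σ 0), a (σ 1)} : Set (EuclideanSpace ℝ (Fin 3))) = Set.range (a ∘ f) := by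
      rw [← e.surjective.range_comp (a ∘ f), ← hpair]
      simp [Matrix.range_cons, Set.pair_comm]
    rw [hr, hspan]
    exact Submodule.subset_span ⟨_, rfl⟩
  obtain ⟨κ₁, κ₂, hκ⟩ := Submodule.mem_span_pair.1 hmem
  refine ⟨σ, κ₁, κ₂, ?_, hκ.symm⟩
  rw [hpair]
  exact hli.comp e e.injective

lemma exists_perm_of_rank_gram_eq_one {a : Fin 3 → EuclideanSpace ℝ (Fin 3)}
    (h : (gram ℝ a).rank = 1) :
    ∃ (σ : Equiv.Perm (Fin 3)) (κ₁ κ₂ : ℝ),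
      a (σ 1) = κ₁ • a (σ 0) ∧ a (σ 2) = κ₂ • a (σ 0) := by
  rw [rank_gram_eq_finrank_span] at h
  obtain ⟨ι, f, hf, hspan, hli⟩ := exists_linearIndependent' ℝ a
  have : Finite ι := Finite.of_injective f hf
  have := Fintype.ofFinite ι
  have hcard : Fintype.card ι = 1 := by rw [← finrank_span_eq_card hli, hspan, h]
  obtain ⟨i, hi⟩ := Fintype.card_eq_one_iff.1 hcard
  have hmem (k : Fin 3) : ∃ κ : ℝ, κ • a (f i) = a k := by
    have hr : ({a (f i)} : Set (EuclideanSpace ℝ (Fin 3))) = Set.range (a ∘ f) := by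
      ext x
      simp only [Set.mem_singleton_iff, Set.mem_range, Function.comp_apply]
      exact ⟨fun hx => ⟨i, hx.symm⟩, fun ⟨j, hj⟩ => by rw [← hj, hi j]⟩
    rw [← Submodule.mem_span_singleton, hr, hspan]
    exact Submodule.subset_span ⟨_, rfl⟩
  obtain ⟨κ₁, h1⟩ := hmem (Equiv.swap 0 (f i) 1)
  obtain ⟨κ₂, h2⟩ := hmem (Equiv.swap 0 (f i) 2)
  exact ⟨Equiv.swap 0 (f i), κ₁, κ₂, by simp [h1], by simp [h2]⟩

lemma meanDensityThree_cases (a₀ : Fin 3 → ℝ) (a : Fin 3 → EuclideanSpace ℝ (Fin 3))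
    (x : Fin 3 → ℝ) :
    (omega a₀ a x < 1 →
        meanDensityThree a₀ a x = 3 / (4 * Real.pi * √(gram ℝ a).det)) ∧
      (omega a₀ a x = 1 →
        meanDensityThree a₀ a x = 3 / (8 * Real.pi * √(gram ℝ a).det)) ∧
      (1 < omega a₀ a x → meanDensityThree a₀ a x = 0) := by
  refine ⟨fun h => ?_, fun h => ?_, fun h => ?_⟩ <;> rw [meanDensityThree]
  · rw [Real.sign_of_pos (by linarith),
      show 8 * Real.pi * √(gram ℝ a).det = 2 * (4 * Real.pi * √(gram ℝ a).det) by ring,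
      show (3 : ℝ) * (1 + 1) = 2 * 3 by norm_num, mul_div_mul_left _ _ two_ne_zero]
  · rw [h, sub_self, Real.sign_zero, add_zero, mul_one]
  · rw [Real.sign_of_neg (by linarith), add_neg_cancel, mul_zero, zero_div]

/-- The observables are `A i = a₀ i 𝟙 + a i · σ` for `i = 0, 1, 2`, and `T` is the Gram matrix of
the vectors `a i`. A permutation `σ` records which of them play which role in the degenerate
cases, and a product of delta functions with a density is the image of that density under the
graph map on which the arguments of the delta functions vanish. -/
theorem proposition9
    (Φ : EuclideanSpace ℂ (Fin 2 × Fin 2)) (hΦ : ‖Φ‖ = 1)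
    (a₀ : Fin 3 → ℝ) (a : Fin 3 → EuclideanSpace ℝ (Fin 3))
    (A : Fin 3 → Matrix (Fin 2) (Fin 2) ℂ) (hA : ∀ i, A i = qubitObservable (a₀ i) (a i))
    (T : Matrix (Fin 3) (Fin 3) ℝ) (hT : T = Matrix.gram ℝ a) :
    -- rank three
    ((T.rank = 3 ↔ LinearIndependent ℝ a) ∧
      (T.rank = 3 →
        meanValueLaw Φ A =
            (volume : Measure (Fin 3 → ℝ)).withDensity
              (fun x => ENNReal.ofReal (meanDensityThree a₀ a x)) ∧
        ∀ x : Fin 3 → ℝ,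
          (omega a₀ a x < 1 → meanDensityThree a₀ a x = 3 / (4 * Real.pi * √T.det)) ∧
          (omega a₀ a x = 1 → meanDensityThree a₀ a x = 3 / (8 * Real.pi * √T.det)) ∧
          (1 < omega a₀ a x → meanDensityThree a₀ a x = 0))) ∧
    -- rank two
    (T.rank = 2 →
      (∃ (σ : Equiv.Perm (Fin 3)) (κ₁ κ₂ : ℝ),
        LinearIndependent ℝ ![a (σ 0), a (σ 1)] ∧
          a (σ 2) = κ₁ • a (σ 0) + κ₂ • a (σ 1)) ∧
      ∀ (σ : Equiv.Perm (Fin 3)) (κ₁ κ₂ : ℝ),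
        LinearIndependent ℝ ![a (σ 0), a (σ 1)] →
        a (σ 2) = κ₁ • a (σ 0) + κ₂ • a (σ 1) →
        meanValueLaw Φ ![A (σ 0), A (σ 1)] =
            (volume : Measure (Fin 2 → ℝ)).withDensity (fun p => ENNReal.ofReal
              (meanDensityTwo ![a₀ (σ 0), a₀ (σ 1)] ![a (σ 0), a (σ 1)] p)) ∧
          meanValueLaw Φ (fun i => A (σ i)) =
            ((volume : Measure (Fin 2 → ℝ)).withDensity (fun p => ENNReal.ofReal
              (meanDensityTwo ![a₀ (σ 0), a₀ (σ 1)] ![a (σ 0), a (σ 1)] p))).map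
              (fun p => ![p 0, p 1,
                a₀ (σ 2) + κ₁ * (p 0 - a₀ (σ 0)) + κ₂ * (p 1 - a₀ (σ 1))])) ∧
    -- rank one
    (T.rank = 1 →
      (∃ (σ : Equiv.Perm (Fin 3)) (κ₁ κ₂ : ℝ),
        a (σ 1) = κ₁ • a (σ 0) ∧ a (σ 2) = κ₂ • a (σ 0)) ∧
      ∀ (σ : Equiv.Perm (Fin 3)) (κ₁ κ₂ : ℝ),
        a (σ 1) = κ₁ • a (σ 0) →
        a (σ 2) = κ₂ • a (σ 0) →
        (reducedStateLaw Φ).map (meanValue (A (σ 0))) =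
            (volume : Measure ℝ).withDensity (fun r => ENNReal.ofReal
              (meanDensityOne (a₀ (σ 0)) (a (σ 0)) r)) ∧
          meanValueLaw Φ (fun i => A (σ i)) =
            ((volume : Measure ℝ).withDensity (fun r => ENNReal.ofReal
              (meanDensityOne (a₀ (σ 0)) (a (σ 0)) r))).map
              (fun r => ![r,
                a₀ (σ 1) + κ₁ * (r - a₀ (σ 0)),
                a₀ (σ 2) + κ₂ * (r - a₀ (σ 0))])) := by
  subst hT
  obtain rfl : A = fun i => qubitObservable (a₀ i) (a i) := funext hA
  refine ⟨⟨rank_gram_eq_iff_linearIndependent a, fun h => ⟨?_, meanDensityThree_cases a₀ a⟩⟩,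
    fun h => ⟨exists_perm_of_rank_gram_eq_two h, fun σ κ₁ κ₂ hli hc => ?_⟩,
    fun h => ⟨exists_perm_of_rank_gram_eq_one h, fun σ κ₁ κ₂ hb hc => ?_⟩⟩
  · rw [meanValueLaw_eq_map_uniformBall hΦ,
      map_uniformBall_three a₀ ((rank_gram_eq_iff_linearIndependent a).1 h)]
  · have hpair : meanValueLaw Φ ![qubitObservable (a₀ (σ 0)) (a (σ 0)),
        qubitObservable (a₀ (σ 1)) (a (σ 1))] =
        uniformBall.map fun x i =>
          ![a₀ (σ 0), a₀ (σ 1)] i + inner ℝ (![a (σ 0), a (σ 1)] i) x := by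
      rw [← meanValueLaw_eq_map_uniformBall hΦ]
      congr 1
      ext1 i
      fin_cases i <;> rfl
    have hlaw := map_uniformBall_two ![a₀ (σ 0), a₀ (σ 1)] hli
    refine ⟨hpair.trans hlaw, ?_⟩
    have hmeas : Measurable fun p : Fin 2 → ℝ => ![p 0, p 1,
        a₀ (σ 2) + κ₁ * (p 0 - a₀ (σ 0)) + κ₂ * (p 1 - a₀ (σ 1))] := by
      refine measurable_pi_lambda _ fun i => ?_
      fin_cases i <;> simp <;> fun_prop
    rw [← hlaw, Measure.map_map hmeas (by fun_prop),
      meanValueLaw_eq_map_uniformBall hΦ (fun i => a₀ (σ i)) (fun i => a (σ i))]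
    congr 1
    ext x i
    fin_cases i
    · simp
    · simp
    · simp [hc, inner_add_left, real_inner_smul_left]
      ring
  · have ha : a (σ 0) ≠ 0 := by
      intro h0
      have hz : a = 0 := by
        ext1 i
        obtain ⟨j, rfl⟩ := σ.surjective i
        fin_cases j
        · exact h0
        · simpa [h0] using hb
        · simpa [h0] using hc
      simp [hz] at h
    have hlaw := map_uniformBall_one (a₀ (σ 0)) ha
    refine ⟨(reducedStateLaw_map_meanValue hΦ _ _).trans hlaw, ?_⟩
    have hmeas : Measurable fun r : ℝ => ![r, a₀ (σ 1) + κ₁ * (r - a₀ (σ 0)),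
        a₀ (σ 2) + κ₂ * (r - a₀ (σ 0))] := by
      refine measurable_pi_lambda _ fun i => ?_
      fin_cases i <;> simp <;> fun_prop
    rw [← hlaw, Measure.map_map hmeas (by fun_prop),
      meanValueLaw_eq_map_uniformBall hΦ (fun i => a₀ (σ i)) (fun i => a (σ i))]
    congr 1
    ext x i
    fin_cases i
    · simp
    · simp [hb, real_inner_smul_left]
    · simp [hc, real_inner_smul_left]
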